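/- For $0<q<1$ and $a\in\mathbb{C}^*$ let $(a;q)_n$ ($n\in\mathbb{Z}$) be the $q$-shifted factorial, i.e. $(a;q)_n=\prod_{k=0}^{n-1}(1-aq^k)$ for $n\ge 0$ and $(a;q)_{n}=\prod_{k=1}^{-n}(1-aq^{-k})^{-1}$ for $n\le -1$, and let $\theta_q(z)=\sum_{n\in\mathbb{Z}}q^{n(n-1)/2}z^n$ for $z\in\mathbb{C}^*$. The $q$-Borel transformation sends a formal bilateral series $\sum_{n\in\mathbb{Z}}c_nx^n$ to $\sum_{n\in\mathbb{Z}}c_nq^{n(n-1)/2}\xi^n$; applied to the divergent series $${}_1\psi_0(a;-;q,x)=\sum_{n\in\mathbb{Z}}(a;q)_n\left\{(-1)^nq^{\frac{n(n-1)}{2}}\right\}^{-1}x^n$$ it gives a series converging on an annulus around $0$, and $\psi_{\mathrm B}$ denotes its sum, continued meromorphically to $\mathbb{C}^*$. Let $$\widetilde\psi^{\mathrm B}_\lambda(x)=\sum_{n\in\mathbb{Z}}\frac{\psi_{\mathrm B}(\lambda q^n)}{\theta_q(\lambda q^n/x)}$$ be its $q$-Laplace transform. Let $\alpha\in\mathbb{C}\setminus\{1,2,3,\dots\}$,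 let $\lambda\in\mathbb{C}^*$ with $-\pi<\arg\lambda<\pi$, let $x\in\mathbb{C}^*$ with $-\pi<\arg(x/\lambda)<\pi$, and put $a=q^\alpha$. Then for all $q<1$ sufficiently close to $1$ the meromorphic continuation $\psi_{\mathrm B}$ exists and is analytic at all points $\lambda q^n$, $\theta_q\bigl(\lambda q^n(1-q)/x\bigr)\ne 0$ for all $n\in\mathbb{Z}$, the series defining $\widetilde\psi^{\mathrm B}_\lambda\left(\frac{x}{1-q}\right)$ converges absolutely, and $$\lim_{q\to 1-0}\widetilde\psi^{\mathrm B}_\lambda\left(\frac{x}{1-q}\right)=\Gamma(1-\alpha)\,x^{-\alpha}\,e^{1/x}.$$ Here $x^{-\alpha}=\lambda^{-\alpha}(x/\lambda)^{-\alpha}$ with principal powers on the right-hand side, i.e. the branch of $x^{-\alpha}$ continuous on the plane cut along the ray $-\lambda[0,\infty)$ whose value at $x=\lambda$ is the principal one. In particular, $x^{-\alpha}$ is the principal power of $x$ whenever $\operatorname{Arg}\lambda+\operatorname{Arg}(x/\lambda)\in(-\pi,\pi]$, where $\operatorname{Arg}$ is the principal argument. -/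

import Mathlib

open Filter Topology

noncomputable section

namespace QBorelLaplace

/-- The `q`-shifted factorial `(a; q)_n` for `n ∈ ℤ`: `(1 - a)(1 - aq)⋯(1 - aq^(n-1))` for `n ≥ 0`
and `[(1 - aq⁻¹)(1 - aq⁻²)⋯(1 - aqⁿ)]⁻¹` for `n ≤ -1`. -/
def qPochhammer (a q : ℂ) : ℤ → ℂ
  | Int.ofNat n => ∏ k ∈ Finset.range n, (1 - a * q ^ k)
  | Int.negSucc n => (∏ k ∈ Finset.range (n + 1), (1 - a * (q ^ (k + 1))⁻¹))⁻¹

/-- The theta function `θ_q(z) = ∑_{n ∈ ℤ} q^(n(n-1)/2) zⁿ`. -/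
def theta (q z : ℂ) : ℂ :=
  ∑' n : ℤ, q ^ (n * (n - 1) / 2) * z ^ n

/-- The coefficients of the (divergent) bilateral series
`₁ψ₀(a; -; q, x) = ∑_{n ∈ ℤ} (a; q)_n {(-1)ⁿ q^(n(n-1)/2)}⁻¹ xⁿ`. A formal bilateral series
`∑_{n ∈ ℤ} c_n xⁿ` is represented by its coefficient family `c : ℤ → ℂ`. -/
def psi10Coeff (a q : ℂ) (n : ℤ) : ℂ :=
  qPochhammer a q n * ((-1) ^ n * q ^ (n * (n - 1) / 2))⁻¹

/-- The `q`-Borel transformation of the first kind on formal bilateral series: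
`∑ c_n xⁿ ↦ ∑ c_n q^(n(n-1)/2) ξⁿ`. -/
def qBorel (q : ℂ) (c : ℤ → ℂ) (n : ℤ) : ℂ :=
  c n * q ^ (n * (n - 1) / 2)

/-- `φ` is the function on `ℂ*` defined by the bilateral series `∑ d_n ξⁿ`: the series converges on
some nonempty annulus to `φ`, and `φ` is meromorphic on `ℂ*`. The normal form only fixes the values
at the isolated singularities (removable ones are removed, the value at a pole is `0`), so that
such a `φ` is unique on `ℂ*`. -/
def IsMeromorphicSum (d : ℤ → ℂ) (φ : ℂ → ℂ) : Prop :=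
  MeromorphicNFOn φ {0}ᶜ ∧
    ∃ r R : ℝ, 0 ≤ r ∧ r < R ∧
      ∀ ξ : ℂ, r < ‖ξ‖ → ‖ξ‖ < R → HasSum (fun n : ℤ => d n * ξ ^ n) (φ ξ)

open Classical in
/-- The meromorphic function on `ℂ*` defined by the bilateral series `∑ d_n ξⁿ` through its sum on
an annulus of convergence and meromorphic continuation (`0` if there is none). -/
def meromorphicSum (d : ℤ → ℂ) : ℂ → ℂ :=
  if h : ∃ φ : ℂ → ℂ, IsMeromorphicSum d φ then h.choose else 0

/-- The terms of the `q`-Laplace transformation of the first kind. -/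
def qLaplaceTerm (q lam : ℂ) (φ : ℂ → ℂ) (x : ℂ) (n : ℤ) : ℂ :=
  φ (lam * q ^ n) / theta q (lam * q ^ n / x)

/-- The `q`-Laplace transformation of the first kind
`(L_{q,λ} φ)(x) = ∑_{n ∈ ℤ} φ(λ qⁿ) / θ_q(λ qⁿ / x)`. -/
def qLaplace (q lam : ℂ) (φ : ℂ → ℂ) (x : ℂ) : ℂ :=
  ∑' n : ℤ, qLaplaceTerm q lam φ x n

/-- `ψ_B`, the `q`-Borel transform of `₁ψ₀(a; -; q, x)`, as a meromorphic function on `ℂ*`. -/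
def psiB (a q : ℂ) : ℂ → ℂ :=
  meromorphicSum (qBorel q (psi10Coeff a q))

/-- `ψ̃^B_λ`, the `q`-Borel-Laplace transform of `₁ψ₀(a; -; q, x)`. -/
def psiTildeB (a q lam x : ℂ) : ℂ :=
  qLaplace q lam (psiB a q) x

/-- The power `x^s = exp (s (Log λ + Log (x/λ)))`: the branch that is continuous in `x` on the
plane cut along the ray `-λ [0, ∞)` and has the principal value at `x = λ`. -/
def powFrom (lam x s : ℂ) : ℂ :=
  Complex.exp (s * (Complex.log lam + Complex.log (x / lam)))

end QBorelLaplace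

end

noncomputable section

namespace QBorelLaplace

/-! For fixed `q` the transform has a closed product form; the limit is then taken factor by factor.

The Borel transformation cancels the Gaussian factor and leaves `∑ (a;q)_n (-ξ)^n`. The case `b = 0`
of Ramanujan's summation (`qInf_mul_bilateral`) gives `ψ_B(ξ) = θ(aξ) / ((q/a;q)_∞ (-ξ;q)_∞)`. Its
possible poles in `ℂ*` lie on the negative axis, so the points `λqⁿ` avoid them. By
quasi-periodicity of theta, the Laplace terms at `λqⁿ` are a constant times `(-λ;q)_n (1/(ax))^n`.
This is the same kind of bilateral series, so Ramanujan's formula applies again. With the triple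
product (`theta_neg_eq_qInf`) the sum becomes (`hasSum_qLaplaceTerm_psiB`) `(q;q)_∞/(q/a;q)_∞ ·
θ(aλ)/θ(λ) · θ(λ/(ax))/θ(λ/x) / (1/(ax);q)_∞`.

Now put `a = q^α` and replace `x` by `x/(1-q)`. The first quotient is a `q`-Gamma function at `1-α`
times `(1-q)^(-α)` (`tendsto_qGamma`). The theta ratios behave like `λ^(-α)` and `(λ(1-q)/x)^α`, by
Jacobi's imaginary transformation (`tendsto_theta_ratio`). The last product tends to `e^(-1/x)`
(`tendsto_qInf_exp`). The powers of `1-q` cancel. -/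

/-- The infinite `q`-shifted factorial `(z; q)_∞ = ∏_{k ≥ 0} (1 - z q^k)`. -/
def qInf (q z : ℂ) : ℂ := ∏' k : ℕ, (1 - z * q ^ k)

/-! ### Infinite `q`-shifted factorials -/

section qInf

variable {q : ℂ}

lemma summable_norm_mul_pow (hq : ‖q‖ < 1) (z : ℂ) : Summable fun k : ℕ => ‖-(z * q ^ k)‖ := by
  simp only [norm_neg, norm_mul, norm_pow]
  exact (summable_geometric_of_lt_one (norm_nonneg q) hq).mul_left _

lemma multipliable_qInf (hq : ‖q‖ < 1) (z : ℂ) : Multipliable fun k : ℕ => 1 - z * q ^ k := by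
  simpa only [sub_eq_add_neg] using multipliable_one_add_of_summable (summable_norm_mul_pow hq z)

lemma tendsto_prod_qInf (hq : ‖q‖ < 1) (z : ℂ) :
    Tendsto (fun n : ℕ => ∏ k ∈ Finset.range n, (1 - z * q ^ k)) atTop (𝓝 (qInf q z)) :=
  (multipliable_qInf hq z).hasProd.tendsto_prod_nat

lemma qInf_ne_zero (hq : ‖q‖ < 1) {z : ℂ} (hz : ∀ k : ℕ, z * q ^ k ≠ 1) : qInf q z ≠ 0 := by
  have := tprod_one_add_ne_zero_of_summable (f := fun k : ℕ => -(z * q ^ k))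
    (fun k => by rw [← sub_eq_add_neg]; exact sub_ne_zero.mpr (hz k).symm)
    (summable_norm_mul_pow hq z)
  simpa only [qInf, sub_eq_add_neg] using this

lemma qInf_ne_zero_of_norm_lt_one (hq : ‖q‖ < 1) {z : ℂ} (hz : ‖z‖ < 1) : qInf q z ≠ 0 := by
  refine qInf_ne_zero hq fun k hk => ?_
  have h := congrArg norm hk
  rw [norm_mul, norm_pow, norm_one] at h
  have : ‖z‖ * ‖q‖ ^ k ≤ ‖z‖ * 1 := by
    gcongr
    exact pow_le_one₀ (norm_nonneg _) hq.le
  linarith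

lemma qInf_eq_one_sub_mul (hq : ‖q‖ < 1) (z : ℂ) : qInf q z = (1 - z) * qInf q (q * z) := by
  have h1 := (tendsto_prod_qInf hq z).comp (tendsto_add_atTop_nat 1)
  refine tendsto_nhds_unique h1 (((tendsto_prod_qInf hq (q * z)).const_mul (1 - z)).congr fun n => ?_)
  simp only [Function.comp, Finset.prod_range_succ']
  rw [mul_comm]
  congr 1
  · exact Finset.prod_congr rfl fun k _ => by ring
  · simp

lemma differentiable_qInf (hq : ‖q‖ < 1) : Differentiable ℂ (qInf q) := by
  intro z₀
  have hU : IsOpen (Metric.ball (0 : ℂ) (‖z₀‖ + 1)) := Metric.isOpen_ball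
  have hu : Summable fun k : ℕ => (‖z₀‖ + 1) * ‖q‖ ^ k :=
    (summable_geometric_of_lt_one (norm_nonneg q) hq).mul_left _
  have h := Summable.hasProdLocallyUniformlyOn_nat_one_add (f := fun (k : ℕ) (z : ℂ) => -(z * q ^ k))
    hU hu (Eventually.of_forall fun k z hz => by
      rw [norm_neg, norm_mul, norm_pow]
      gcongr
      exact (mem_ball_zero_iff.mp hz).le) (fun k => by fun_prop)
  have hd : DifferentiableOn ℂ (fun z => ∏' k : ℕ, (1 + -(z * q ^ k)))
      (Metric.ball (0 : ℂ) (‖z₀‖ + 1)) := by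
    refine (hasProdLocallyUniformlyOn_iff_tendstoLocallyUniformlyOn.mp h).differentiableOn
      (Eventually.of_forall fun s => ?_) hU
    refine DifferentiableOn.fun_finsetProd fun k _ => ?_
    fun_prop
  have := hd.differentiableAt (hU.mem_nhds (by simp : z₀ ∈ Metric.ball (0 : ℂ) (‖z₀‖ + 1)))
  simp only [← sub_eq_add_neg] at this
  exact this

/-- The partial products of a nonvanishing `(z; q)_∞` are bounded away from zero. -/
lemma exists_le_norm_prod (hq : ‖q‖ < 1) {z : ℂ} (hz : ∀ k : ℕ, z * q ^ k ≠ 1) :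
    ∃ c > 0, ∀ n : ℕ, c ≤ ‖∏ k ∈ Finset.range n, (1 - z * q ^ k)‖ := by
  obtain ⟨C, hC⟩ := ((tendsto_prod_qInf hq z).inv₀ (qInf_ne_zero hq hz)).norm.bddAbove_range
  have hpos : ∀ n : ℕ, 0 < ‖∏ k ∈ Finset.range n, (1 - z * q ^ k)‖ := fun n =>
    norm_pos_iff.mpr (Finset.prod_ne_zero_iff.mpr fun k _ => sub_ne_zero.mpr (hz k).symm)
  have hC' : ∀ n : ℕ, ‖∏ k ∈ Finset.range n, (1 - z * q ^ k)‖⁻¹ ≤ C := fun n => by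
    simpa using hC ⟨n, rfl⟩
  have hC0 : 0 < C := lt_of_lt_of_le (inv_pos.mpr (hpos 0)) (hC' 0)
  exact ⟨C⁻¹, inv_pos.mpr hC0, fun n => inv_le_of_inv_le₀ (hpos n) (hC' n)⟩

lemma exists_norm_prod_le (hq : ‖q‖ < 1) (z : ℂ) :
    ∃ C > 0, ∀ n : ℕ, ‖∏ k ∈ Finset.range n, (1 - z * q ^ k)‖ ≤ C := by
  obtain ⟨C, hC⟩ := (tendsto_prod_qInf hq z).norm.bddAbove_range
  have h0 := hC ⟨0, rfl⟩
  simp only [Finset.range_zero, Finset.prod_empty, norm_one] at h0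
  exact ⟨C, by linarith, fun n => hC ⟨n, rfl⟩⟩

end qInf

/-! ### The theta function: convergence, quasi-periodicity, analyticity -/

section theta

variable {q : ℂ}

lemma triangle_add_one (n : ℤ) : (n + 1) * (n + 1 - 1) / 2 = n * (n - 1) / 2 + n := by
  rw [show (n + 1) * (n + 1 - 1) = n * (n - 1) + n * 2 by ring]
  exact Int.add_mul_ediv_right _ _ (by norm_num)

lemma theta_term_add_one (hq0 : q ≠ 0) {z : ℂ} (hz : z ≠ 0) (n : ℤ) :
    q ^ ((n + 1) * (n + 1 - 1) / 2) * z ^ (n + 1) = q ^ n * z * (q ^ (n * (n - 1) / 2) * z ^ n) := by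
  rw [triangle_add_one, zpow_add₀ hq0, zpow_add_one₀ hz]
  ring

lemma two_mul_triangle (n : ℤ) : 2 * (n * (n - 1) / 2) = n * (n - 1) :=
  Int.mul_ediv_cancel' (Int.even_mul_pred_self n).two_dvd

/-- The exponent is `n² l/2 + n(u - l/2)`, to be matched with `πi n² τ + 2πi n z`; the shift by
`l/2` comes from `n(n-1)` in place of `n²`. -/
lemma theta_term_eq_jacobiTheta₂_term (l u : ℂ) (n : ℤ) :
    Complex.exp l ^ (n * (n - 1) / 2) * Complex.exp u ^ n =
      jacobiTheta₂_term n ((u - l / 2) / (2 * Real.pi * Complex.I))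
        (l / (2 * Real.pi * Complex.I)) := by
  have h2 : (2 : ℂ) * ((n * (n - 1) / 2 : ℤ) : ℂ) = n * (n - 1) := by
    exact_mod_cast two_mul_triangle n
  have hpi : (Real.pi : ℂ) ≠ 0 := by exact_mod_cast Real.pi_ne_zero
  rw [jacobiTheta₂_term, ← Complex.exp_int_mul, ← Complex.exp_int_mul, ← Complex.exp_add]
  congr 1
  have h3 : ((n * (n - 1) / 2 : ℤ) : ℂ) = n * (n - 1) / 2 := by rw [← h2]; ring
  rw [h3]
  field_simp
  ring

lemma im_div_two_pi_I (l : ℂ) : (l / (2 * Real.pi * Complex.I)).im = -l.re / (2 * Real.pi) := by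
  have hpi : (Real.pi : ℂ) ≠ 0 := by exact_mod_cast Real.pi_ne_zero
  have : l / (2 * Real.pi * Complex.I) = ((1 / (2 * Real.pi) : ℝ) : ℂ) * (-(l * Complex.I)) := by
    push_cast
    field_simp
    rw [Complex.I_sq]
    ring
  rw [this, Complex.im_ofReal_mul]
  simp
  ring

lemma summable_theta_term (hq0 : q ≠ 0) (hq : ‖q‖ < 1) {z : ℂ} (hz : z ≠ 0) :
    Summable fun n : ℤ => q ^ (n * (n - 1) / 2) * z ^ n := by
  have h : (fun n : ℤ => q ^ (n * (n - 1) / 2) * z ^ n) = fun n => jacobiTheta₂_term n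
      ((Complex.log z - Complex.log q / 2) / (2 * Real.pi * Complex.I))
        (Complex.log q / (2 * Real.pi * Complex.I)) := by
    funext n
    rw [← theta_term_eq_jacobiTheta₂_term, Complex.exp_log hq0, Complex.exp_log hz]
  rw [h, summable_jacobiTheta₂_term_iff, im_div_two_pi_I, Complex.log_re]
  have := Real.log_neg (norm_pos_iff.mpr hq0) hq
  have := Real.pi_pos
  apply div_pos <;> linarith

lemma theta_eq_jacobiTheta₂ (l u : ℂ) : theta (Complex.exp l) (Complex.exp u) =
    jacobiTheta₂ ((u - l / 2) / (2 * Real.pi * Complex.I)) (l / (2 * Real.pi * Complex.I)) :=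
  tsum_congr fun n => theta_term_eq_jacobiTheta₂_term l u n

lemma theta_eq_mul (hq0 : q ≠ 0) {z : ℂ} (hz : z ≠ 0) :
    theta q z = z * theta q (q * z) := by
  rw [theta, theta, ← tsum_mul_left, ← (Equiv.addRight (1 : ℤ)).tsum_eq]
  refine tsum_congr fun n => ?_
  rw [Equiv.coe_addRight, theta_term_add_one hq0 hz, mul_zpow]
  ring

lemma differentiableAt_theta (hq0 : q ≠ 0) (hq : ‖q‖ < 1) {z : ℂ} (hz : z ≠ 0) :
    DifferentiableAt ℂ (theta q) z := by
  obtain ⟨R, hR⟩ := exists_gt (max ‖z‖ ‖z‖⁻¹)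
  have hzp := norm_pos_iff.mpr hz
  have hR1 : ‖z‖ < R := (le_max_left _ _).trans_lt hR
  have hR2 : R⁻¹ < ‖z‖ := inv_lt_of_inv_lt₀ hzp ((le_max_right _ _).trans_lt hR)
  have hR0 : 0 < R := hzp.trans hR1
  have hRc : (R : ℂ) ≠ 0 := by exact_mod_cast hR0.ne'
  let U : Set ℂ := {w | ‖w‖ < R} ∩ {w | R⁻¹ < ‖w‖}
  have hU : IsOpen U := (isOpen_lt continuous_norm continuous_const).inter
    (isOpen_lt continuous_const continuous_norm)
  -- On the annulus `1/R < |w| < R` one has `|w|^n ≤ R^n + R^(-n)` for either sign of `n`, so two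
  -- theta series form the majorant.
  have hu := (summable_theta_term hq0 hq hRc).norm.add
    (summable_theta_term hq0 hq (inv_ne_zero hRc)).norm
  have hd : DifferentiableOn ℂ (theta q) U := by
    refine Complex.differentiableOn_tsum_of_summable_norm hu (fun n w hw => ?_) hU ?_
    · have hw0 : w ≠ 0 := norm_pos_iff.mp ((inv_pos.mpr hR0).trans hw.2)
      exact ((differentiableAt_zpow.mpr (Or.inl hw0)).const_mul _).differentiableWithinAt
    · rintro n w ⟨hw1, hw2⟩
      have hw1 : ‖w‖ < R := hw1
      have hw2 : R⁻¹ < ‖w‖ := hw2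
      simp only [norm_mul, norm_zpow, norm_inv, Complex.norm_real, Real.norm_of_nonneg hR0.le]
      rw [← mul_add]
      gcongr
      rcases le_total 0 n with hn | hn
      · have : ‖w‖ ^ n ≤ R ^ n := zpow_le_zpow_left₀ hn (norm_nonneg _) hw1.le
        have : 0 < R⁻¹ ^ n := by positivity
        linarith
      · have : ‖w‖ ^ n ≤ R⁻¹ ^ n := by
          obtain ⟨m, rfl⟩ := Int.exists_eq_neg_ofNat hn
          rw [zpow_neg, zpow_neg]
          refine inv_anti₀ (by positivity) ?_
          exact zpow_le_zpow_left₀ (by positivity) (by positivity) hw2.le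
        have : 0 < R ^ n := by positivity
        linarith
  exact hd.differentiableAt (hU.mem_nhds ⟨hR1, hR2⟩)

end theta

/-! ### Ramanujan's bilateral summation and the triple product -/

section bilateral

variable {q a : ℂ}

/-- The condition `a ≠ q^(k+1)` keeps nonzero the factors inverted in `(a;q)_n` for `n < 0`. If one
vanished, the convention `0⁻¹ = 0` would break the recurrence of `(a;q)_n`. -/
lemma one_sub_mul_inv_pow_ne_zero (hq0 : q ≠ 0) (ha : ∀ k : ℕ, a ≠ q ^ (k + 1)) (k : ℕ) :
    1 - a * (q ^ (k + 1))⁻¹ ≠ 0 := by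
  intro h
  apply ha k
  have hk : q ^ (k + 1) ≠ 0 := pow_ne_zero _ hq0
  field_simp at h
  linear_combination -h

lemma one_sub_mul_zpow_ne_zero (hq0 : q ≠ 0) (ha : ∀ k : ℕ, a ≠ q ^ (k + 1)) {n : ℤ} (hn : n < 0) :
    1 - a * q ^ n ≠ 0 := by
  obtain ⟨k, rfl⟩ := Int.eq_negSucc_of_lt_zero hn
  rw [zpow_negSucc]
  exact one_sub_mul_inv_pow_ne_zero hq0 ha k

@[simp] lemma qPochhammer_zero : qPochhammer a q 0 = 1 := by
  change ∏ k ∈ Finset.range 0, (1 - a * q ^ k) = 1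
  simp

lemma qPochhammer_add_one (hq0 : q ≠ 0) (ha : ∀ k : ℕ, a ≠ q ^ (k + 1)) (n : ℤ) :
    qPochhammer a q (n + 1) = (1 - a * q ^ n) * qPochhammer a q n := by
  match n with
  | Int.ofNat n =>
    change ∏ k ∈ Finset.range (n + 1), (1 - a * q ^ k) = _ * ∏ k ∈ Finset.range n, (1 - a * q ^ k)
    rw [Finset.prod_range_succ, mul_comm]
    simp
  | Int.negSucc 0 =>
    have h := one_sub_mul_inv_pow_ne_zero hq0 ha 0
    rw [show Int.negSucc 0 + 1 = 0 from rfl, qPochhammer_zero, zpow_negSucc]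
    change 1 = _ * (∏ k ∈ Finset.range (0 + 1), (1 - a * (q ^ (k + 1))⁻¹))⁻¹
    simp only [Finset.prod_range_succ, Finset.range_zero, Finset.prod_empty, one_mul]
    exact (mul_inv_cancel₀ h).symm
  | Int.negSucc (n + 1) =>
    have h := one_sub_mul_inv_pow_ne_zero hq0 ha (n + 1)
    rw [show Int.negSucc (n + 1) + 1 = Int.negSucc n by rfl, zpow_negSucc]
    change (∏ k ∈ Finset.range (n + 1), (1 - a * (q ^ (k + 1))⁻¹))⁻¹ =
      _ * (∏ k ∈ Finset.range (n + 1 + 1), (1 - a * (q ^ (k + 1))⁻¹))⁻¹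
    rw [Finset.prod_range_succ _ (n + 1), mul_inv, mul_comm, mul_assoc, inv_mul_cancel₀ h, mul_one]

lemma div_ne_pow (hq0 : q ≠ 0) (ha : ∀ k : ℕ, a ≠ q ^ (k + 1)) (k : ℕ) : a / q ≠ q ^ (k + 1) := by
  intro h
  apply ha (k + 1)
  rw [div_eq_iff hq0] at h
  rw [h, pow_succ _ (k + 1)]

lemma qPochhammer_div_add_one (hq0 : q ≠ 0) (ha : ∀ k : ℕ, a ≠ q ^ (k + 1)) (n : ℤ) :
    qPochhammer (a / q) q (n + 1) = (1 - a / q) * qPochhammer a q n := by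
  have ha' := div_ne_pow hq0 ha
  have key : ∀ n : ℤ, 1 - a / q * q ^ (n + 1) = 1 - a * q ^ n := fun n => by
    rw [zpow_add_one₀ hq0]
    field_simp
  induction n with
  | zero => rw [qPochhammer_add_one hq0 ha']; simp
  | succ n ih => rw [qPochhammer_add_one hq0 ha', ih, qPochhammer_add_one hq0 ha, key]; ring
  | pred n ih =>
    have h0 : 1 - a * q ^ (-(n : ℤ) - 1) ≠ 0 := one_sub_mul_zpow_ne_zero hq0 ha (by lia)
    have h1 := qPochhammer_add_one hq0 ha' (-(n : ℤ) - 1 + 1)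
    have h2 := qPochhammer_add_one hq0 ha (-(n : ℤ) - 1)
    rw [key, sub_add_cancel] at h1
    rw [sub_add_cancel] at h2 ⊢
    apply mul_left_cancel₀ h0
    rw [← h1, ih, h2]
    ring

/-- The terms of `∑_{n ∈ ℤ} (a; q)_n zⁿ`. -/
def bilateralTerm (q a z : ℂ) (n : ℤ) : ℂ := qPochhammer a q n * z ^ n

lemma bilateralTerm_add_one (hq0 : q ≠ 0) (ha : ∀ k : ℕ, a ≠ q ^ (k + 1)) {z : ℂ} (hz : z ≠ 0)
    (n : ℤ) : bilateralTerm q a z (n + 1) = (1 - a * q ^ n) * z * bilateralTerm q a z n := by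
  rw [bilateralTerm, bilateralTerm, qPochhammer_add_one hq0 ha, zpow_add_one₀ hz]
  ring

lemma hasSum_add_one {f : ℤ → ℂ} {S : ℂ} (h : HasSum f S) : HasSum (fun n => f (n + 1)) S :=
  (Equiv.hasSum_iff (f := f) (Equiv.addRight (1 : ℤ))).mpr h

/-- The contiguity relation in the variable. -/
lemma hasSum_bilateralTerm_mul (hq0 : q ≠ 0) (ha0 : a ≠ 0) (ha : ∀ k : ℕ, a ≠ q ^ (k + 1))
    {z S : ℂ} (hz : z ≠ 0) (h : HasSum (bilateralTerm q a z) S) :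
    HasSum (bilateralTerm q a (q * z)) (-(1 - z) / (a * z) * S) := by
  have h2 := (h.sub ((hasSum_add_one h).mul_left z⁻¹)).mul_left a⁻¹
  rw [show -(1 - z) / (a * z) * S = a⁻¹ * (S - z⁻¹ * S) by field_simp; ring]
  refine h2.congr_fun fun n => ?_
  rw [bilateralTerm_add_one hq0 ha hz, bilateralTerm, bilateralTerm, mul_zpow]
  field_simp
  ring

/-- The contiguity relation in the parameter. -/
lemma hasSum_bilateralTerm_div (hq0 : q ≠ 0) (ha : ∀ k : ℕ, a ≠ q ^ (k + 1))
    {z S : ℂ} (hz : z ≠ 0) (h : HasSum (bilateralTerm q a z) S) :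
    HasSum (bilateralTerm q (a / q) z) (z * (1 - a / q) * S) := by
  rw [← (Equiv.addRight (1 : ℤ)).hasSum_iff]
  refine (h.mul_left (z * (1 - a / q))).congr_fun fun n => ?_
  simp only [Function.comp, Equiv.coe_addRight, bilateralTerm]
  rw [qPochhammer_div_add_one hq0 ha, zpow_add_one₀ hz]
  ring

lemma div_pow_ne_pow (hq0 : q ≠ 0) (ha : ∀ k : ℕ, a ≠ q ^ (k + 1)) (n k : ℕ) :
    a / q ^ n ≠ q ^ (k + 1) := by
  intro h
  apply ha (k + n)
  rw [div_eq_iff (pow_ne_zero _ hq0)] at h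
  rw [h]
  ring

lemma div_mul_pow_ne_one (ha0 : a ≠ 0) (ha : ∀ k : ℕ, a ≠ q ^ (k + 1)) (k : ℕ) :
    q / a * q ^ k ≠ 1 := by
  intro h
  apply ha k
  field_simp at h
  rw [← h]
  ring

/-- Applying both contiguity relations once replaces `(a, z)` by `(a/q, qz)` and multiplies the sum
by `z(1 - a/q) · (-(1-z)q/(az)) = (1 - q/a)(1 - z)`. Iteration builds the partial products of
`(q/a;q)_∞ (z;q)_∞`, while `az` stays fixed. -/
lemma hasSum_bilateralTerm_iterate (hq0 : q ≠ 0) (ha0 : a ≠ 0) (ha : ∀ k : ℕ, a ≠ q ^ (k + 1))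
    {z S : ℂ} (hz : z ≠ 0) (h : HasSum (bilateralTerm q a z) S) (n : ℕ) :
    HasSum (bilateralTerm q (a / q ^ n) (q ^ n * z))
      ((∏ k ∈ Finset.range n, (1 - q / a * q ^ k)) * (∏ k ∈ Finset.range n, (1 - z * q ^ k)) * S) := by
  induction n with
  | zero => simpa using h
  | succ n ih =>
    have hn : q ^ n ≠ 0 := pow_ne_zero _ hq0
    have hA := div_pow_ne_pow hq0 ha n
    have h1 := hasSum_bilateralTerm_div hq0 hA (mul_ne_zero hn hz) ih
    have h2 := hasSum_bilateralTerm_mul hq0 (div_ne_zero (div_ne_zero ha0 hn) hq0)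
      (div_ne_pow hq0 hA) (mul_ne_zero hn hz) h1
    convert h2 using 1
    · congr 1
      · rw [pow_succ, div_div]
      · rw [pow_succ]; ring
    · rw [Finset.prod_range_succ, Finset.prod_range_succ]
      field_simp
      ring

/-- The rescaled coefficients `(a q⁻ⁿ; q)_k q^(nk)` satisfy a two-term recurrence. -/
lemma bilateralTerm_rescaled_add_one (hq0 : q ≠ 0) (ha : ∀ k : ℕ, a ≠ q ^ (k + 1)) {z : ℂ}
    (hz : z ≠ 0) (n : ℕ) (k : ℤ) :
    bilateralTerm q (a / q ^ n) (q ^ n * z) (k + 1) =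
      (q ^ n - a * q ^ k) * z * bilateralTerm q (a / q ^ n) (q ^ n * z) k := by
  have hn : q ^ n ≠ 0 := pow_ne_zero _ hq0
  rw [bilateralTerm_add_one hq0 (div_pow_ne_pow hq0 ha n) (mul_ne_zero hn hz)]
  field_simp

lemma bilateralTerm_zero (z : ℂ) : bilateralTerm q a z 0 = 1 := by simp [bilateralTerm]

lemma pow_sub_mul_zpow_ne_zero (hq0 : q ≠ 0) (ha : ∀ k : ℕ, a ≠ q ^ (k + 1)) (n : ℕ) {k : ℤ}
    (hk : k < 0) : q ^ n - a * q ^ k ≠ 0 := by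
  have h := one_sub_mul_zpow_ne_zero hq0 (div_pow_ne_pow hq0 ha n) hk
  have hn : q ^ n ≠ 0 := pow_ne_zero _ hq0
  intro h0
  apply h
  field_simp
  linear_combination h0

/-- As `qⁿ → 0`, the recurrence factor `(qⁿ - a q^k) z` tends to the ratio of consecutive terms of
`θ(-az)`. Convergence spreads from `k = 0` in both directions. -/
lemma tendsto_bilateralTerm_rescaled (hq0 : q ≠ 0) (hq : ‖q‖ < 1) (ha0 : a ≠ 0)
    (ha : ∀ k : ℕ, a ≠ q ^ (k + 1)) {z : ℂ} (hz : z ≠ 0) (k : ℤ) :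
    Tendsto (fun n : ℕ => bilateralTerm q (a / q ^ n) (q ^ n * z) k) atTop
      (𝓝 (q ^ (k * (k - 1) / 2) * (-(a * z)) ^ k)) := by
  have hz' : -(a * z) ≠ 0 := neg_ne_zero.mpr (mul_ne_zero ha0 hz)
  have hf : ∀ k : ℤ, Tendsto (fun n : ℕ => (q ^ n - a * q ^ k) * z) atTop
      (𝓝 (q ^ k * (-(a * z)))) := fun k => by
    have := ((tendsto_pow_atTop_nhds_zero_of_norm_lt_one hq).sub_const (a * q ^ k)).mul_const z
    convert this using 2
    ring
  induction k with
  | zero => simp [bilateralTerm_zero]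
  | succ k ih =>
    rw [theta_term_add_one hq0 hz']
    refine ((hf k).mul ih).congr fun n => ?_
    rw [bilateralTerm_rescaled_add_one hq0 ha hz]
  | pred k ih =>
    have hne : q ^ (-(k : ℤ) - 1) * (-(a * z)) ≠ 0 := mul_ne_zero (zpow_ne_zero _ hq0) hz'
    have hT := theta_term_add_one hq0 hz' (-(k : ℤ) - 1)
    rw [sub_add_cancel] at hT
    have h := ih.div (hf (-(k : ℤ) - 1)) hne
    rw [hT, mul_div_cancel_left₀ _ hne] at h
    refine h.congr fun n => ?_
    have hR := bilateralTerm_rescaled_add_one hq0 ha hz n (-(k : ℤ) - 1)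
    rw [sub_add_cancel] at hR
    rw [Pi.div_apply, hR, mul_div_cancel_left₀]
    exact mul_ne_zero (pow_sub_mul_zpow_ne_zero hq0 ha n (by lia)) hz

lemma norm_bilateralTerm_rescaled_natCast_le (hq0 : q ≠ 0) (hq : ‖q‖ < 1)
    (ha : ∀ k : ℕ, a ≠ q ^ (k + 1)) {z : ℂ} (hz : z ≠ 0) (n k : ℕ) :
    ‖bilateralTerm q (a / q ^ n) (q ^ n * z) k‖ ≤
      (∏ j ∈ Finset.range k, (1 + ‖a‖ * ‖q‖ ^ j)) * ‖z‖ ^ k := by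
  induction k with
  | zero => simp [bilateralTerm_zero]
  | succ k ih =>
    push_cast
    rw [bilateralTerm_rescaled_add_one hq0 ha hz, Finset.prod_range_succ, norm_mul, norm_mul]
    have h1 : ‖q ^ n - a * q ^ (k : ℤ)‖ ≤ 1 + ‖a‖ * ‖q‖ ^ k := by
      refine (norm_sub_le _ _).trans ?_
      rw [norm_pow, norm_mul, zpow_natCast, norm_pow]
      gcongr
      exact pow_le_one₀ (norm_nonneg _) hq.le
    calc _ ≤ (1 + ‖a‖ * ‖q‖ ^ k) * ‖z‖ *
          ((∏ j ∈ Finset.range k, (1 + ‖a‖ * ‖q‖ ^ j)) * ‖z‖ ^ k) := by gcongr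
      _ = _ := by ring

/-- For negative indices the quotient by the theta term is exactly a ratio of two partial products
of `(q/a;q)_∞`, which can be bounded uniformly in `n`. -/
lemma bilateralTerm_rescaled_neg_mul (hq0 : q ≠ 0) (ha0 : a ≠ 0)
    (ha : ∀ k : ℕ, a ≠ q ^ (k + 1)) {z : ℂ} (hz : z ≠ 0) (n m : ℕ) :
    bilateralTerm q (a / q ^ n) (q ^ n * z) (-m) *
        (∏ k ∈ Finset.range (n + m), (1 - q / a * q ^ k)) =
      (∏ k ∈ Finset.range n, (1 - q / a * q ^ k)) *
        (q ^ ((-m : ℤ) * (-m - 1) / 2) * (-(a * z)) ^ (-m : ℤ)) := by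
  have hz' : -(a * z) ≠ 0 := neg_ne_zero.mpr (mul_ne_zero ha0 hz)
  induction m with
  | zero => simp [bilateralTerm_zero]
  | succ m ih =>
    have hR := bilateralTerm_rescaled_add_one hq0 ha hz n (-(m : ℤ) - 1)
    have hT := theta_term_add_one hq0 hz' (-(m : ℤ) - 1)
    rw [sub_add_cancel] at hR hT
    have hne : q ^ (-(m : ℤ) - 1) * (-(a * z)) ≠ 0 := mul_ne_zero (zpow_ne_zero _ hq0) hz'
    rw [show (-((m + 1 : ℕ) : ℤ)) = -(m : ℤ) - 1 by push_cast; ring]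
    apply mul_left_cancel₀ hne
    rw [mul_left_comm _ (∏ k ∈ Finset.range n, _), ← hT, ← ih, hR, ← add_assoc,
      Finset.prod_range_succ]
    have hfac : q ^ (-(m : ℤ) - 1) * -(a * z) * (1 - q / a * q ^ (n + m)) =
        (q ^ n - a * q ^ (-(m : ℤ) - 1)) * z := by
      have hm : q ^ m ≠ 0 := pow_ne_zero _ hq0
      rw [show (-(m : ℤ) - 1) = -((m + 1 : ℕ) : ℤ) by push_cast; ring, zpow_neg, zpow_natCast]
      field_simp
      ring
    rw [← hfac]
    ring

lemma exists_bound_bilateralTerm_rescaled (hq0 : q ≠ 0) (hq : ‖q‖ < 1) (ha0 : a ≠ 0)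
    (ha : ∀ k : ℕ, a ≠ q ^ (k + 1)) {z : ℂ} (hz : z ≠ 0) (hz1 : ‖z‖ < 1) :
    ∃ b : ℤ → ℝ, Summable b ∧
      ∀ (n : ℕ) (k : ℤ), ‖bilateralTerm q (a / q ^ n) (q ^ n * z) k‖ ≤ b k := by
  have hz' : -(a * z) ≠ 0 := neg_ne_zero.mpr (mul_ne_zero ha0 hz)
  obtain ⟨c, hc, hcle⟩ := exists_le_norm_prod hq (div_mul_pow_ne_one ha0 ha)
  obtain ⟨C, hC, hCle⟩ := exists_norm_prod_le hq (q / a)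
  obtain ⟨D, hD, hDle⟩ := exists_norm_prod_le (q := ((‖q‖ : ℝ) : ℂ)) (by simpa using hq)
    (-(‖a‖ : ℂ))
  have hDle' : ∀ k : ℕ, ∏ j ∈ Finset.range k, (1 + ‖a‖ * ‖q‖ ^ j) ≤ D := fun k => by
    refine le_trans (le_of_eq ?_) (hDle k)
    have : ∏ j ∈ Finset.range k, (1 - -(‖a‖ : ℂ) * (‖q‖ : ℂ) ^ j) =
        ((∏ j ∈ Finset.range k, (1 + ‖a‖ * ‖q‖ ^ j) : ℝ) : ℂ) := by
      push_cast
      exact Finset.prod_congr rfl fun j _ => by ring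
    rw [this, Complex.norm_real, Real.norm_of_nonneg]
    exact Finset.prod_nonneg fun j _ => by positivity
  -- The geometric summand serves `k ≥ 0`, the theta summand `k ≤ 0`; adding them gives one summable
  -- majorant.
  refine ⟨fun k => D * ‖z‖ ^ k.natAbs +
    C / c * ‖q ^ (k * (k - 1) / 2) * (-(a * z)) ^ k‖, ?_, fun n k => ?_⟩
  · refine Summable.add (Summable.mul_left _ ?_) ((summable_theta_term hq0 hq hz').norm.mul_left _)
    have hg := summable_geometric_of_lt_one (norm_nonneg z) hz1
    exact Summable.of_nat_of_neg (by simpa using hg) (by simpa using hg)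
  · obtain ⟨m, rfl | rfl⟩ := Int.eq_nat_or_neg k
    · refine (norm_bilateralTerm_rescaled_natCast_le hq0 hq ha hz n m).trans ?_
      beta_reduce
      rw [Int.natAbs_natCast]
      have : (∏ j ∈ Finset.range m, (1 + ‖a‖ * ‖q‖ ^ j)) * ‖z‖ ^ m ≤ D * ‖z‖ ^ m := by
        gcongr
        exact hDle' m
      have : 0 ≤ C / c * ‖q ^ ((m : ℤ) * (m - 1) / 2) * (-(a * z)) ^ (m : ℤ)‖ := by positivity
      linarith
    · have h := congrArg norm (bilateralTerm_rescaled_neg_mul hq0 ha0 ha hz n m)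
      rw [norm_mul, norm_mul _ (q ^ _ * _)] at h
      set T := ‖q ^ ((-m : ℤ) * (-m - 1) / 2) * (-(a * z)) ^ (-m : ℤ)‖
      set X := ‖bilateralTerm q (a / q ^ n) (q ^ n * z) (-m)‖
      have h1 : X * c ≤ C * T := by
        calc X * c ≤ _ := mul_le_mul_of_nonneg_left (hcle (n + m)) (norm_nonneg _)
          _ = _ := h
          _ ≤ C * T := mul_le_mul_of_nonneg_right (hCle n) (norm_nonneg _)
      have h2 : X ≤ C / c * T := by
        rw [div_mul_eq_mul_div, le_div_iff₀ hc]
        exact h1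
      have : 0 ≤ D * ‖z‖ ^ (-(m : ℤ)).natAbs := by positivity
      linarith

lemma summable_bilateralTerm (hq0 : q ≠ 0) (hq : ‖q‖ < 1) (ha0 : a ≠ 0)
    (ha : ∀ k : ℕ, a ≠ q ^ (k + 1)) {z : ℂ} (hz : z ≠ 0) (hz1 : ‖z‖ < 1) :
    Summable (bilateralTerm q a z) := by
  obtain ⟨b, hb, hle⟩ := exists_bound_bilateralTerm_rescaled hq0 hq ha0 ha hz hz1
  exact Summable.of_norm_bounded hb fun k => by simpa using hle 0 k

/-- The case `b = 0` of Ramanujan's `₁ψ₁` summation, wherever the series converges. -/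
theorem qInf_mul_bilateral (hq0 : q ≠ 0) (hq : ‖q‖ < 1) (ha0 : a ≠ 0)
    (ha : ∀ k : ℕ, a ≠ q ^ (k + 1)) {z S : ℂ} (hz : z ≠ 0) (h : HasSum (bilateralTerm q a z) S) :
    qInf q (q / a) * qInf q z * S = theta q (-(a * z)) := by
  -- Domination needs `|z| < 1`. Any other point of convergence is moved there by `z ↦ qz`, under
  -- which both sides transform alike.
  obtain ⟨n, hn⟩ : ∃ n : ℕ, ‖q ^ n * z‖ < 1 := by
    have : Tendsto (fun n : ℕ => ‖q ^ n * z‖) atTop (𝓝 ‖(0 : ℂ) * z‖) :=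
      ((tendsto_pow_atTop_nhds_zero_of_norm_lt_one hq).mul_const z).norm
    rw [zero_mul, norm_zero] at this
    exact (this.eventually_lt_const one_pos).exists
  induction n generalizing z S with
  | zero =>
    rw [pow_zero, one_mul] at hn
    obtain ⟨b, hb, hle⟩ := exists_bound_bilateralTerm_rescaled hq0 hq ha0 ha hz hn
    have h1 := tendsto_tsum_of_dominated_convergence hb
      (tendsto_bilateralTerm_rescaled hq0 hq ha0 ha hz) (Eventually.of_forall hle)
    refine tendsto_nhds_unique ?_ h1
    refine (((tendsto_prod_qInf hq (q / a)).mul (tendsto_prod_qInf hq z)).mul_const S).congr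
      fun n => ?_
    exact (hasSum_bilateralTerm_iterate hq0 ha0 ha hz h n).tsum_eq.symm
  | succ n ih =>
    have h1 := ih (mul_ne_zero hq0 hz) (hasSum_bilateralTerm_mul hq0 ha0 ha hz h)
      (by rwa [← mul_assoc, ← pow_succ])
    rw [theta_eq_mul hq0 (neg_ne_zero.mpr (mul_ne_zero ha0 hz)),
      show q * -(a * z) = -(a * (q * z)) by ring, ← h1, qInf_eq_one_sub_mul hq z]
    field_simp

lemma hasSum_int_telescope {f : ℤ → ℂ} {l m : ℂ} (hs : Summable fun n : ℤ => f (n + 1) - f n)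
    (hl : Tendsto (fun n : ℕ => f n) atTop (𝓝 l)) (hm : Tendsto (fun n : ℕ => f (-n)) atTop (𝓝 m)) :
    HasSum (fun n : ℤ => f (n + 1) - f n) (l - m) := by
  have hs1 : Summable fun n : ℕ => f ((n : ℤ) + 1) - f n :=
    hs.comp_injective (i := fun n : ℕ => (n : ℤ)) Nat.cast_injective
  have hs2 : Summable fun n : ℕ => f (-((n : ℤ) + 1) + 1) - f (-((n : ℤ) + 1)) :=
    hs.comp_injective (i := fun n : ℕ => -((n : ℤ) + 1)) fun m n h => by simpa using h
  have e1 : ∑' n : ℕ, (f ((n : ℤ) + 1) - f n) = l - f 0 := by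
    refine tendsto_nhds_unique hs1.hasSum.tendsto_sum_nat ((hl.sub_const (f 0)).congr fun n => ?_)
    have := Finset.sum_range_sub (fun n : ℕ => f n) n
    push_cast at this
    exact this.symm
  have e2 : ∑' n : ℕ, (f (-((n : ℤ) + 1) + 1) - f (-((n : ℤ) + 1))) = f 0 - m := by
    refine tendsto_nhds_unique hs2.hasSum.tendsto_sum_nat ((hm.const_sub (f 0)).congr fun n => ?_)
    have := Finset.sum_range_sub' (fun n : ℕ => f (-(n : ℤ))) n
    push_cast at this
    rw [neg_zero] at this
    rw [← this]
    refine Finset.sum_congr rfl fun k _ => ?_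
    rw [neg_add, neg_add_cancel_right]
  have hsum := HasSum.of_nat_of_neg_add_one (f := fun n : ℤ => f (n + 1) - f n) hs1.hasSum hs2.hasSum
  rwa [e1, e2, sub_add_sub_cancel] at hsum

/-- At `z = q` the series telescopes: `-a qⁿ (a;q)_n = (a;q)_(n+1) - (a;q)_n`, with limits `(a;q)_∞`
at `+∞` and `0` at `-∞`. -/
lemma hasSum_bilateralTerm_self (hq0 : q ≠ 0) (hq : ‖q‖ < 1) (ha0 : a ≠ 0)
    (ha : ∀ k : ℕ, a ≠ q ^ (k + 1)) :
    HasSum (bilateralTerm q a q) (-(qInf q a / a)) := by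
  have hs := summable_bilateralTerm hq0 hq ha0 ha hq0 hq
  have hd : ∀ n : ℤ, -a * bilateralTerm q a q n = qPochhammer a q (n + 1) - qPochhammer a q n := by
    intro n
    rw [qPochhammer_add_one hq0 ha, bilateralTerm]
    ring
  have hneg : Tendsto (fun n : ℕ => qPochhammer a q (-(n : ℤ))) atTop (𝓝 0) := by
    have h0 := (summable_int_iff_summable_nat_and_neg.mp hs).2.tendsto_atTop_zero.mul
      (tendsto_pow_atTop_nhds_zero_of_norm_lt_one hq)
    rw [zero_mul] at h0
    refine h0.congr fun n => ?_
    have : q ^ n ≠ 0 := pow_ne_zero _ hq0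
    rw [bilateralTerm, zpow_neg, zpow_natCast, mul_assoc, inv_mul_cancel₀ this, mul_one]
  have hsum := hasSum_int_telescope ((hs.mul_left (-a)).congr hd) (tendsto_prod_qInf hq a) hneg
  have h2 := hsum.mul_left (-a)⁻¹
  rw [show (-a)⁻¹ * (qInf q a - 0) = -(qInf q a / a) by rw [inv_neg]; ring] at h2
  refine h2.congr_fun fun n => ?_
  rw [← hd, inv_mul_cancel_left₀ (neg_ne_zero.mpr ha0)]

/-- **Jacobi's triple product identity**. -/
theorem theta_neg_eq_qInf (hq0 : q ≠ 0) (hq : ‖q‖ < 1) (ha0 : a ≠ 0)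
    (ha : ∀ k : ℕ, a ≠ q ^ (k + 1)) :
    theta q (-a) = qInf q q * qInf q a * qInf q (q / a) := by
  have h := qInf_mul_bilateral hq0 hq ha0 ha hq0 (hasSum_bilateralTerm_self hq0 hq ha0 ha)
  rw [theta_eq_mul hq0 (neg_ne_zero.mpr ha0), show q * -a = -(a * q) by ring, ← h]
  field_simp

end bilateral

/-! ### Uniqueness of meromorphic continuation -/

section identity

/-- Identity theorem for meromorphic functions in normal form. -/
lemma eventuallyEq_of_meromorphicNFOn {f g : ℂ → ℂ} {U : Set ℂ} (hU : IsPreconnected U)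
    (hf : MeromorphicNFOn f U) (hg : MeromorphicNFOn g U) {x y : ℂ} (hx : x ∈ U) (hy : y ∈ U)
    (h : f =ᶠ[𝓝[≠] x] g) : f =ᶠ[𝓝 y] g := by
  have hfg : MeromorphicOn (f - g) U := hf.meromorphicOn.sub hg.meromorphicOn
  have hx' : meromorphicOrderAt (f - g) x = ⊤ := by
    rw [meromorphicOrderAt_eq_top_iff]
    filter_upwards [h] with z hz
    simp [hz]
  have hy' : meromorphicOrderAt (f - g) y = ⊤ := by
    by_contra hne
    exact hfg.meromorphicOrderAt_ne_top_of_isPreconnected hU hy hx hne hx'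
  rw [meromorphicOrderAt_eq_top_iff] at hy'
  -- Normal form turns agreement on a punctured neighbourhood into agreement at the centre as well.
  refine ((hf hy).eventuallyEq_nhdsNE_iff_eventuallyEq_nhds (hg hy)).mp ?_
  filter_upwards [hy'] with z hz
  exact sub_eq_zero.mp hz

lemma isPreconnected_compl_zero : IsPreconnected ({0}ᶜ : Set ℂ) :=
  (isConnected_compl_singleton_of_one_lt_rank (by simp) 0).isPreconnected

end identity

/-! ### Closed form of the Borel transform -/

section borel

variable {q : ℝ} {a : ℂ}

lemma norm_ofReal_lt_one (hq0 : 0 < q) (hq1 : q < 1) : ‖(q : ℂ)‖ < 1 := by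
  rwa [Complex.norm_real, Real.norm_of_nonneg hq0.le]

/-- The zeros of `(-w;q)_∞` and, by the triple product, of `θ_q(w)` are negative reals. This lemma
is how the slit-plane hypotheses exclude them. -/
lemma neg_mul_ofReal_ne_one {w : ℂ} (hw : w ∈ Complex.slitPlane) {r : ℝ} (hr : 0 < r) :
    -w * (r : ℂ) ≠ 1 := by
  intro h
  have hr' : (r : ℂ) ≠ 0 := by exact_mod_cast hr.ne'
  have h1 : w = ((-r⁻¹ : ℝ) : ℂ) := by
    push_cast
    field_simp
    linear_combination -h
  rw [h1, Complex.ofReal_mem_slitPlane] at hw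
  have := inv_pos.mpr hr
  linarith

lemma qInf_neg_ne_zero (hq0 : 0 < q) (hq1 : q < 1) {w : ℂ} (hw : w ∈ Complex.slitPlane) :
    qInf q (-w) ≠ 0 := by
  refine qInf_ne_zero (norm_ofReal_lt_one hq0 hq1) fun k => ?_
  have := neg_mul_ofReal_ne_one hw (pow_pos hq0 k)
  push_cast at this
  exact this

lemma neg_ne_ofReal_pow (hq0 : 0 < q) {w : ℂ} (hw : w ∈ Complex.slitPlane) (k : ℕ) :
    -w ≠ (q : ℂ) ^ (k + 1) := by
  intro h
  have h1 := neg_mul_ofReal_ne_one hw (inv_pos.mpr (pow_pos hq0 (k + 1)))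
  have : (q : ℂ) ≠ 0 := by exact_mod_cast hq0.ne'
  apply h1
  rw [h]
  push_cast
  exact mul_inv_cancel₀ (pow_ne_zero _ this)

lemma theta_eq_qInf (hq0 : 0 < q) (hq1 : q < 1) {w : ℂ} (hw : w ∈ Complex.slitPlane) :
    theta q w = qInf q q * qInf q (-w) * qInf q (q / -w) := by
  have h := theta_neg_eq_qInf (by exact_mod_cast hq0.ne') (norm_ofReal_lt_one hq0 hq1)
    (neg_ne_zero.mpr (Complex.slitPlane_ne_zero hw)) (neg_ne_ofReal_pow hq0 hw)
  rwa [neg_neg] at h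

lemma theta_ne_zero (hq0 : 0 < q) (hq1 : q < 1) {w : ℂ} (hw : w ∈ Complex.slitPlane) :
    theta q w ≠ 0 := by
  have hq := norm_ofReal_lt_one hq0 hq1
  rw [theta_eq_qInf hq0 hq1 hw]
  exact mul_ne_zero (mul_ne_zero (qInf_ne_zero_of_norm_lt_one hq hq) (qInf_neg_ne_zero hq0 hq1 hw))
    (qInf_ne_zero hq (div_mul_pow_ne_one (neg_ne_zero.mpr (Complex.slitPlane_ne_zero hw))
      (neg_ne_ofReal_pow hq0 hw)))

lemma mul_ofReal_mem_slitPlane {w : ℂ} (hw : w ∈ Complex.slitPlane) {r : ℝ} (hr : 0 < r) :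
    w * (r : ℂ) ∈ Complex.slitPlane := by
  rw [Complex.mem_slitPlane_iff] at hw ⊢
  rw [Complex.re_mul_ofReal, Complex.im_mul_ofReal]
  rcases hw with h | h
  · exact Or.inl (mul_pos h hr)
  · exact Or.inr (mul_ne_zero h hr.ne')

/-- The closed form of the `q`-Borel transform of `₁ψ₀(a; -; q, x)`. -/
def borelClosed (q a ξ : ℂ) : ℂ := theta q (a * ξ) / (qInf q (q / a) * qInf q (-ξ))

lemma qBorel_mul_zpow {q : ℂ} (hq0 : q ≠ 0) (ξ : ℂ) (n : ℤ) :
    qBorel q (psi10Coeff a q) n * ξ ^ n = bilateralTerm q a (-ξ) n := by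
  have h : q ^ (n * (n - 1) / 2) ≠ 0 := zpow_ne_zero _ hq0
  have h1 : ((-1 : ℂ) ^ n)⁻¹ = (-1) ^ n := by rw [← inv_zpow, inv_neg_one]
  rw [qBorel, psi10Coeff, bilateralTerm, mul_inv, neg_eq_neg_one_mul ξ, mul_zpow, h1]
  field_simp

/-- Only convergence at `ξ` is assumed, since the annulus furnished by `IsMeromorphicSum` is not
known explicitly. -/
lemma eq_borelClosed {q : ℂ} (hq0 : q ≠ 0) (hq : ‖q‖ < 1) (ha0 : a ≠ 0)
    (ha : ∀ k : ℕ, a ≠ q ^ (k + 1)) {ξ S : ℂ} (hξ : ξ ≠ 0) (hξ' : qInf q (-ξ) ≠ 0)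
    (h : HasSum (bilateralTerm q a (-ξ)) S) : S = borelClosed q a ξ := by
  have h1 := qInf_mul_bilateral hq0 hq ha0 ha (neg_ne_zero.mpr hξ) h
  have h2 := qInf_ne_zero hq (div_mul_pow_ne_one ha0 ha)
  rw [borelClosed, eq_div_iff (mul_ne_zero h2 hξ'), ← neg_neg (a * ξ), ← mul_neg, ← h1]
  ring

lemma analyticAt_theta {q : ℂ} (hq0 : q ≠ 0) (hq : ‖q‖ < 1) {z : ℂ} (hz : z ≠ 0) :
    AnalyticAt ℂ (theta q) z := by
  rw [Complex.analyticAt_iff_eventually_differentiableAt]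
  filter_upwards [isOpen_ne.mem_nhds hz] with w hw
  exact differentiableAt_theta hq0 hq hw

lemma analyticAt_theta_mul {q : ℂ} (hq0 : q ≠ 0) (hq : ‖q‖ < 1) (ha0 : a ≠ 0) {z : ℂ}
    (hz : z ≠ 0) : AnalyticAt ℂ (fun ξ => theta q (a * ξ)) z :=
  (analyticAt_theta hq0 hq (mul_ne_zero ha0 hz)).comp (f := fun ξ => a * ξ)
    (analyticAt_const.mul analyticAt_id)

lemma analyticAt_qInf_neg {q : ℂ} (hq : ‖q‖ < 1) (c z : ℂ) :
    AnalyticAt ℂ (fun ξ => c * qInf q (-ξ)) z :=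
  analyticAt_const.mul (((differentiable_qInf hq).analyticAt (-z)).comp (f := fun ξ => -ξ)
    analyticAt_id.neg)

lemma meromorphicOn_borelClosed {q : ℂ} (hq0 : q ≠ 0) (hq : ‖q‖ < 1) (ha0 : a ≠ 0) :
    MeromorphicOn (borelClosed q a) {0}ᶜ := fun _ hz =>
  (analyticAt_theta_mul hq0 hq ha0 hz).meromorphicAt.div
    (analyticAt_qInf_neg hq (qInf q (q / a)) _).meromorphicAt

lemma analyticAt_borelClosed {q : ℂ} (hq0 : q ≠ 0) (hq : ‖q‖ < 1) (ha0 : a ≠ 0)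
    (ha : ∀ k : ℕ, a ≠ q ^ (k + 1)) {ξ : ℂ} (hξ : ξ ≠ 0) (hξ' : qInf q (-ξ) ≠ 0) :
    AnalyticAt ℂ (borelClosed q a) ξ :=
  (analyticAt_theta_mul hq0 hq ha0 hξ).div (analyticAt_qInf_neg hq (qInf q (q / a)) _)
    (mul_ne_zero (qInf_ne_zero hq (div_mul_pow_ne_one ha0 ha)) hξ')

lemma toMeromorphicNFOn_eq_of_analyticAt {f : ℂ → ℂ} {U : Set ℂ} (hf : MeromorphicOn f U) {x : ℂ}
    (hx : x ∈ U) (hfx : AnalyticAt ℂ f x) : toMeromorphicNFOn f U =ᶠ[𝓝 x] f :=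
  ((meromorphicNFOn_toMeromorphicNFOn f U hx).eventuallyEq_nhdsNE_iff_eventuallyEq_nhds
    hfx.meromorphicNFAt).mp (hf.toMeromorphicNFOn_eq_self_on_nhdsNE hx)

lemma isMeromorphicSum_toMeromorphicNFOn {q : ℂ} (hq0 : q ≠ 0) (hq : ‖q‖ < 1) (ha0 : a ≠ 0)
    (ha : ∀ k : ℕ, a ≠ q ^ (k + 1)) :
    IsMeromorphicSum (qBorel q (psi10Coeff a q)) (toMeromorphicNFOn (borelClosed q a) {0}ᶜ) := by
  refine ⟨meromorphicNFOn_toMeromorphicNFOn _ _, 0, 1, le_rfl, one_pos, fun ξ h0 h1 => ?_⟩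
  have hξ : ξ ≠ 0 := norm_pos_iff.mp h0
  have hξ' : qInf q (-ξ) ≠ 0 := qInf_ne_zero_of_norm_lt_one hq (by rwa [norm_neg])
  have hs := summable_bilateralTerm hq0 hq ha0 ha (neg_ne_zero.mpr hξ) (by rwa [norm_neg])
  rw [(toMeromorphicNFOn_eq_of_analyticAt (meromorphicOn_borelClosed hq0 hq ha0) hξ
    (analyticAt_borelClosed hq0 hq ha0 ha hξ hξ')).eq_of_nhds,
    ← eq_borelClosed hq0 hq ha0 ha hξ hξ' hs.hasSum]
  exact hs.hasSum.congr_fun (qBorel_mul_zpow hq0 ξ)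

lemma isMeromorphicSum_psiB {q : ℂ} (hq0 : q ≠ 0) (hq : ‖q‖ < 1) (ha0 : a ≠ 0)
    (ha : ∀ k : ℕ, a ≠ q ^ (k + 1)) :
    IsMeromorphicSum (qBorel q (psi10Coeff a q)) (psiB a q) := by
  have h : ∃ φ, IsMeromorphicSum (qBorel q (psi10Coeff a q)) φ :=
    ⟨_, isMeromorphicSum_toMeromorphicNFOn hq0 hq ha0 ha⟩
  rw [psiB, meromorphicSum, dif_pos h]
  exact h.choose_spec

/-- `psiB` is an arbitrary choice of continuation, with its own annulus. It agrees with the closed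
form near a positive real point `ρ` of that annulus, and the identity theorem on `ℂ*` carries this
to `ξ`. -/
lemma psiB_eventuallyEq (hq0 : 0 < q) (hq1 : q < 1) (ha0 : a ≠ 0)
    (ha : ∀ k : ℕ, a ≠ (q : ℂ) ^ (k + 1)) {ξ : ℂ} (hξ : ξ ∈ Complex.slitPlane) :
    psiB a q =ᶠ[𝓝 ξ] borelClosed q a := by
  have hq0' : (q : ℂ) ≠ 0 := by exact_mod_cast hq0.ne'
  have hq := norm_ofReal_lt_one hq0 hq1
  have hmer := meromorphicOn_borelClosed hq0' hq ha0
  have han : ∀ w ∈ Complex.slitPlane, AnalyticAt ℂ (borelClosed q a) w := fun w hw =>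
    analyticAt_borelClosed hq0' hq ha0 ha (Complex.slitPlane_ne_zero hw)
      (qInf_neg_ne_zero hq0 hq1 hw)
  obtain ⟨hnf, r, R, hr, hrR, hsum⟩ := isMeromorphicSum_psiB hq0' hq ha0 ha
  obtain ⟨ρ, hρ1, hρ2⟩ := exists_between hrR
  have hρ0 : 0 < ρ := hr.trans_lt hρ1
  have hρs : (ρ : ℂ) ∈ Complex.slitPlane := Complex.ofReal_mem_slitPlane.mpr hρ0
  have hρn : ‖(ρ : ℂ)‖ = ρ := by rw [Complex.norm_real, Real.norm_of_nonneg hρ0.le]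
  have hloc : psiB a q =ᶠ[𝓝 (ρ : ℂ)] borelClosed q a := by
    filter_upwards [Complex.isOpen_slitPlane.mem_nhds hρs,
      (isOpen_lt continuous_const continuous_norm).mem_nhds (hρn.symm ▸ hρ1 : r < ‖(ρ : ℂ)‖),
      (isOpen_lt continuous_norm continuous_const).mem_nhds (hρn.symm ▸ hρ2 : ‖(ρ : ℂ)‖ < R)]
      with w hw1 hw2 hw3
    exact eq_borelClosed hq0' hq ha0 ha (Complex.slitPlane_ne_zero hw1)
      (qInf_neg_ne_zero hq0 hq1 hw1)
      ((hsum w hw2 hw3).congr_fun fun n => (qBorel_mul_zpow hq0' w n).symm)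
  have hloc' := hloc.trans (toMeromorphicNFOn_eq_of_analyticAt hmer
    (Complex.slitPlane_ne_zero hρs) (han _ hρs)).symm
  have hglob := eventuallyEq_of_meromorphicNFOn isPreconnected_compl_zero hnf
    (meromorphicNFOn_toMeromorphicNFOn (borelClosed q a) {0}ᶜ) (Complex.slitPlane_ne_zero hρs)
    (Complex.slitPlane_ne_zero hξ) (hloc'.filter_mono nhdsWithin_le_nhds)
  exact hglob.trans (toMeromorphicNFOn_eq_of_analyticAt hmer (Complex.slitPlane_ne_zero hξ)
    (han _ hξ))

end borel

/-! ### The Laplace series in closed form -/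

section laplace

variable {q : ℂ}

lemma theta_mul_zpow (hq0 : q ≠ 0) {z : ℂ} (hz : z ≠ 0) (n : ℤ) :
    q ^ (n * (n - 1) / 2) * z ^ n * theta q (z * q ^ n) = theta q z := by
  have step : ∀ n : ℤ, q ^ ((n + 1) * (n + 1 - 1) / 2) * z ^ (n + 1) * theta q (z * q ^ (n + 1)) =
      q ^ (n * (n - 1) / 2) * z ^ n * theta q (z * q ^ n) := fun n => by
    rw [theta_term_add_one hq0 hz, theta_eq_mul hq0 (mul_ne_zero hz (zpow_ne_zero n hq0)),
      zpow_add_one₀ hq0, show q * (z * q ^ n) = z * (q ^ n * q) by ring]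
    ring
  induction n with
  | zero => simp
  | succ n ih => rw [step, ih]
  | pred n ih =>
    have := step (-(n : ℤ) - 1)
    rw [sub_add_cancel] at this
    rw [← this, ih]

lemma qInf_mul_qPochhammer (hq0 : q ≠ 0) (hq : ‖q‖ < 1) {b : ℂ} (hb : ∀ k : ℕ, b ≠ q ^ (k + 1))
    (n : ℤ) : qPochhammer b q n * qInf q (b * q ^ n) = qInf q b := by
  have step : ∀ n : ℤ, qPochhammer b q (n + 1) * qInf q (b * q ^ (n + 1)) =
      qPochhammer b q n * qInf q (b * q ^ n) := fun n => by
    rw [qPochhammer_add_one hq0 hb, qInf_eq_one_sub_mul hq (b * q ^ n), zpow_add_one₀ hq0,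
      show q * (b * q ^ n) = b * (q ^ n * q) by ring]
    ring
  induction n with
  | zero => simp
  | succ n ih => rw [step, ih]
  | pred n ih =>
    have := step (-(n : ℤ) - 1)
    rw [sub_add_cancel] at this
    rw [← this, ih]

end laplace

section laplace

variable {q : ℝ} {a lam x : ℂ}

lemma ofReal_zpow_mem {w : ℂ} (hq0 : 0 < q) (hw : w ∈ Complex.slitPlane) (n : ℤ) :
    w * (q : ℂ) ^ n ∈ Complex.slitPlane := by
  have := mul_ofReal_mem_slitPlane hw (zpow_pos hq0 n)
  push_cast at this
  exact this

lemma theta_laplace_ne_zero (hq0 : 0 < q) (hq1 : q < 1) (hx : lam / x ∈ Complex.slitPlane) (n : ℤ) :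
    theta q (lam * (q : ℂ) ^ n / x) ≠ 0 := by
  rw [mul_div_right_comm]
  exact theta_ne_zero hq0 hq1 (ofReal_zpow_mem hq0 hx n)

/-- Shifting by `qⁿ` produces the same Gaussian power in `θ(aλqⁿ)` and `θ(λqⁿ/x)`. It cancels and
leaves `(1/(ax))^n`, while `(-λqⁿ;q)_∞` contributes `(-λ;q)_n`. -/
lemma qLaplaceTerm_psiB (hq0 : 0 < q) (hq1 : q < 1) (ha0 : a ≠ 0)
    (ha : ∀ k : ℕ, a ≠ (q : ℂ) ^ (k + 1)) (hlam : lam ∈ Complex.slitPlane)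
    (hx : lam / x ∈ Complex.slitPlane) (n : ℤ) :
    qLaplaceTerm q lam (psiB a q) x n =
      theta q (a * lam) / (theta q (lam / x) * qInf q (q / a) * qInf q (-lam)) *
        bilateralTerm q (-lam) (1 / (a * x)) n := by
  have hq0' : (q : ℂ) ≠ 0 := by exact_mod_cast hq0.ne'
  have hq := norm_ofReal_lt_one hq0 hq1
  have hl0 := Complex.slitPlane_ne_zero hlam
  have hx0 : x ≠ 0 := fun h => by
    rw [h, div_zero] at hx
    exact Complex.slitPlane_ne_zero hx rfl
  have hln := ofReal_zpow_mem hq0 hlam n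
  rw [qLaplaceTerm, (psiB_eventuallyEq hq0 hq1 ha0 ha hln).eq_of_nhds, borelClosed,
    mul_div_right_comm, ← mul_assoc, bilateralTerm, neg_mul_eq_neg_mul]
  have e1 := theta_mul_zpow hq0' (mul_ne_zero ha0 hl0) n
  have e2 := theta_mul_zpow hq0' (div_ne_zero hl0 hx0) n
  have e3 := qInf_mul_qPochhammer hq0' hq (neg_ne_ofReal_pow hq0 hlam) n
  have n2 := theta_ne_zero hq0 hq1 (ofReal_zpow_mem hq0 hx n)
  have n3 := qInf_neg_ne_zero hq0 hq1 hlam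
  have n4 := qInf_ne_zero hq (div_mul_pow_ne_one ha0 ha)
  have n5 : (q : ℂ) ^ (n * (n - 1) / 2) ≠ 0 := zpow_ne_zero _ hq0'
  rw [← e3] at n3
  rw [← e1, ← e2, ← e3]
  have n6 := left_ne_zero_of_mul n3
  have n7 := right_ne_zero_of_mul n3
  have n8 : lam ^ n ≠ 0 := zpow_ne_zero _ hl0
  have n9 : a ^ n ≠ 0 := zpow_ne_zero _ ha0
  have n10 : x ^ n ≠ 0 := zpow_ne_zero _ hx0
  rw [one_div, inv_zpow, mul_zpow, mul_zpow, div_zpow]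
  field_simp

/-- The Laplace series converges to a product of theta functions. -/
lemma hasSum_qLaplaceTerm_psiB (hq0 : 0 < q) (hq1 : q < 1) (ha0 : a ≠ 0)
    (ha : ∀ k : ℕ, a ≠ (q : ℂ) ^ (k + 1)) (hlam : lam ∈ Complex.slitPlane)
    (hx : lam / x ∈ Complex.slitPlane) (hax : ‖1 / (a * x)‖ < 1) :
    HasSum (qLaplaceTerm q lam (psiB a q) x)
      (qInf q q / qInf q (q / a) * (theta q (a * lam) / theta q lam) *
        (theta q (lam / x / a) / theta q (lam / x)) / qInf q (1 / (a * x))) := by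
  have hq0' : (q : ℂ) ≠ 0 := by exact_mod_cast hq0.ne'
  have hq := norm_ofReal_lt_one hq0 hq1
  have hl0 := Complex.slitPlane_ne_zero hlam
  have hx0 : x ≠ 0 := fun h => by
    rw [h, div_zero] at hx
    exact Complex.slitPlane_ne_zero hx rfl
  have hz0 : 1 / (a * x) ≠ 0 := one_div_ne_zero (mul_ne_zero ha0 hx0)
  have hb := neg_ne_ofReal_pow hq0 hlam
  have hs := (summable_bilateralTerm hq0' hq (neg_ne_zero.mpr hl0) hb hz0 hax).hasSum
  have hS := qInf_mul_bilateral hq0' hq (neg_ne_zero.mpr hl0) hb hz0 hs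
  set S := ∑' n, bilateralTerm q (-lam) (1 / (a * x)) n
  have h := (hs.mul_left (theta q (a * lam) /
    (theta q (lam / x) * qInf q (q / a) * qInf q (-lam)))).congr_fun
    (qLaplaceTerm_psiB hq0 hq1 ha0 ha hlam hx)
  suffices hsum : ∀ T, T = theta q (a * lam) / (theta q (lam / x) * qInf q (q / a) *
      qInf q (-lam)) * S → HasSum (qLaplaceTerm q lam (psiB a q) x) T by
    apply hsum
    have n1 := qInf_ne_zero_of_norm_lt_one hq hax
    have n2 := theta_ne_zero hq0 hq1 hx
    have n3 := theta_ne_zero hq0 hq1 hlam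
    have n4 := qInf_ne_zero hq (div_mul_pow_ne_one ha0 ha)
    -- The triple product for `θ(λ)` absorbs `(-λ;q)_∞` and the factor `(q/(-λ);q)_∞` from the
    -- second summation, at the cost of `(q;q)_∞`.
    rw [theta_eq_qInf hq0 hq1 hlam] at n3 ⊢
    have n5 := right_ne_zero_of_mul n3
    have n6 := right_ne_zero_of_mul (left_ne_zero_of_mul n3)
    have n7 := left_ne_zero_of_mul (left_ne_zero_of_mul n3)
    rw [show lam / x / a = -(-lam * (1 / (a * x))) by field_simp, ← hS]
    generalize qInf (q : ℂ) (q / -lam) = Z at n5 ⊢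
    field_simp
  rintro _ rfl
  exact h

end laplace

/-! ### The `q`-exponential limit -/

section exponential

lemma tendsto_ofReal_nhdsLT_one : Tendsto (fun q : ℝ => (q : ℂ)) (𝓝[<] 1) (𝓝 1) := by
  have : Tendsto (fun q : ℝ => (q : ℂ)) (𝓝 1) (𝓝 ((1 : ℝ) : ℂ)) := Complex.continuous_ofReal.tendsto 1
  rw [Complex.ofReal_one] at this
  exact this.mono_left nhdsWithin_le_nhds

lemma eventually_mem_Ioo_nhdsLT_one : ∀ᶠ q : ℝ in 𝓝[<] 1, 0 < q ∧ q < 1 :=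
  Ioo_mem_nhdsLT one_pos

/-- For small `w (1 - q)`, the logarithm of `(w (1 - q); q)_∞` is close to `-w`. -/
lemma exists_qInf_eq_exp {q : ℝ} (hq0 : 0 < q) (hq1 : q < 1) {w : ℂ}
    (hw : ‖w‖ * (1 - q) ≤ 1 / 2) :
    ∃ L : ℂ, Complex.exp L = qInf q (w * (1 - q)) ∧ ‖L + w‖ ≤ ‖w‖ ^ 2 * (1 - q) := by
  have hq := norm_ofReal_lt_one hq0 hq1
  have hq1' : 0 < 1 - q := sub_pos.mpr hq1
  have h1q : (1 - q : ℂ) ≠ 0 := by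
    have : ((1 - q : ℝ) : ℂ) ≠ 0 := by exact_mod_cast hq1'.ne'
    simpa using this
  have hnq : ‖(1 - q : ℂ)‖ = 1 - q := by
    have : (1 - q : ℂ) = ((1 - q : ℝ) : ℂ) := by push_cast; rfl
    rw [this, Complex.norm_real, Real.norm_of_nonneg hq1'.le]
  let f : ℕ → ℂ := fun k => -(w * (1 - q) * (q : ℂ) ^ k)
  have hfn : ∀ k, ‖f k‖ = ‖w‖ * (1 - q) * q ^ k := fun k => by
    simp only [f, norm_neg, norm_mul, norm_pow, hnq, Complex.norm_real, Real.norm_of_nonneg hq0.le]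
  have hf2 : ∀ k, ‖f k‖ ≤ 1 / 2 := fun k => by
    rw [hfn]
    refine le_trans ?_ hw
    exact mul_le_of_le_one_right (by positivity) (pow_le_one₀ hq0.le hq1.le)
  have hne : ∀ k, 1 + f k ≠ 0 := fun k h => by
    have : ‖f k‖ = 1 := by rw [eq_neg_of_add_eq_zero_right h, norm_neg, norm_one]
    linarith [hf2 k]
  have hlog : ∀ k, ‖Complex.log (1 + f k) - f k‖ ≤ ‖w‖ ^ 2 * (1 - q) ^ 2 * q ^ k := fun k => by
    have h1 := Complex.norm_log_one_add_sub_self_le (z := f k) (by linarith [hf2 k])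
    have h2 : (1 - ‖f k‖)⁻¹ ≤ 2 := by
      rw [inv_le_comm₀ (by linarith [hf2 k]) (by norm_num)]
      linarith [hf2 k]
    have h3 : ‖f k‖ ^ 2 * (1 - ‖f k‖)⁻¹ / 2 ≤ ‖f k‖ ^ 2 := by
      have := mul_le_mul_of_nonneg_left h2 (sq_nonneg ‖f k‖)
      linarith
    refine (h1.trans h3).trans ?_
    rw [hfn, mul_pow, mul_pow]
    gcongr
    rw [sq]
    exact mul_le_of_le_one_left (by positivity) (pow_le_one₀ hq0.le hq1.le)
  have hgeo : HasSum (fun k : ℕ => ‖w‖ ^ 2 * (1 - q) ^ 2 * q ^ k) (‖w‖ ^ 2 * (1 - q)) := by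
    have := (hasSum_geometric_of_lt_one hq0.le hq1).mul_left (‖w‖ ^ 2 * (1 - q) ^ 2)
    rwa [show ‖w‖ ^ 2 * (1 - q) ^ 2 * (1 - q)⁻¹ = ‖w‖ ^ 2 * (1 - q) by field_simp] at this
  -- The first-order parts of the logarithms sum exactly to `-w`; only the quadratic errors need
  -- estimating.
  have hfs : HasSum f (-w) := by
    have := (hasSum_geometric_of_norm_lt_one hq).mul_left (-(w * (1 - q)))
    rw [show -(w * (1 - q : ℂ)) * (1 - q : ℂ)⁻¹ = -w by field_simp] at this
    exact this.congr_fun fun k => by simp only [f]; ring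
  have hds : Summable fun k => Complex.log (1 + f k) - f k := Summable.of_norm_bounded hgeo.summable hlog
  have hls : Summable fun k => Complex.log (1 + f k) := by
    simpa using hds.add hfs.summable
  refine ⟨∑' k, Complex.log (1 + f k), ?_, ?_⟩
  · rw [Complex.cexp_tsum_eq_tprod hne hls, qInf]
    exact tprod_congr fun k => by simp only [f]; ring
  · have h1 : ∑' k, (Complex.log (1 + f k) - f k) = (∑' k, Complex.log (1 + f k)) + w := by
      rw [hls.tsum_sub hfs.summable, hfs.tsum_eq, sub_neg_eq_add]
    rw [← h1]
    exact tsum_of_norm_bounded hgeo hlog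

/-- The argument `w` varies with `q` because it will be `1/(q^α x)`. -/
lemma tendsto_qInf_exp {w : ℝ → ℂ} {w₀ : ℂ} (hw : Tendsto w (𝓝[<] 1) (𝓝 w₀)) :
    Tendsto (fun q : ℝ => qInf q (w q * (1 - q))) (𝓝[<] 1) (𝓝 (Complex.exp (-w₀))) := by
  have h1q : Tendsto (fun q : ℝ => 1 - q) (𝓝[<] 1) (𝓝 0) := by
    have : Tendsto (fun q : ℝ => 1 - q) (𝓝 1) (𝓝 (1 - 1)) := tendsto_const_nhds.sub tendsto_id
    rw [sub_self] at this
    exact this.mono_left nhdsWithin_le_nhds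
  have hsmall : ∀ᶠ q : ℝ in 𝓝[<] 1, ‖w q‖ * (1 - q) ≤ 1 / 2 := by
    have := hw.norm.mul h1q
    rw [mul_zero] at this
    exact this.eventually_le_const (by norm_num)
  have hL : ∀ q : ℝ, ∃ L : ℂ, (0 < q ∧ q < 1) → ‖w q‖ * (1 - q) ≤ 1 / 2 →
      Complex.exp L = qInf q (w q * (1 - q)) ∧ ‖L + w q‖ ≤ ‖w q‖ ^ 2 * (1 - q) := fun q => by
    by_cases h : (0 < q ∧ q < 1) ∧ ‖w q‖ * (1 - q) ≤ 1 / 2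
    · obtain ⟨L, hL⟩ := exists_qInf_eq_exp h.1.1 h.1.2 h.2
      exact ⟨L, fun _ _ => hL⟩
    · exact ⟨0, fun h1 h2 => absurd ⟨h1, h2⟩ h⟩
  choose L hL using hL
  have hz : Tendsto (fun q => L q + w q) (𝓝[<] 1) (𝓝 0) := by
    have hb := (hw.norm.pow 2).mul h1q
    rw [mul_zero] at hb
    refine squeeze_zero_norm' ?_ hb
    filter_upwards [eventually_mem_Ioo_nhdsLT_one, hsmall] with q h1 h2 using (hL q h1 h2).2
  have hlim : Tendsto L (𝓝[<] 1) (𝓝 (-w₀)) := by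
    have := hz.sub hw
    simpa using this
  refine (hlim.cexp).congr' ?_
  filter_upwards [eventually_mem_Ioo_nhdsLT_one, hsmall] with q h1 h2 using (hL q h1 h2).1

end exponential

/-! ### Theta functions as `q → 1` -/

section thetaAsymptotics

/-- Jacobi's imaginary transformation in the multiplicative variable. -/
lemma theta_exp_eq {h : ℝ} (hh : 0 < h) (u : ℂ) :
    theta (Complex.exp (-h)) (Complex.exp u) =
      1 / (((h / (2 * Real.pi) : ℝ) : ℂ) ^ (1 / 2 : ℂ)) * Complex.exp ((u + h / 2) ^ 2 / (2 * h)) *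
        jacobiTheta₂ (-(u + h / 2) / h) (2 * Real.pi * Complex.I / h) := by
  have hpi : (Real.pi : ℂ) ≠ 0 := by exact_mod_cast Real.pi_ne_zero
  have hh' : (h : ℂ) ≠ 0 := by exact_mod_cast hh.ne'
  have hI := Complex.I_ne_zero
  rw [theta_eq_jacobiTheta₂, jacobiTheta₂_functional_equation]
  have e1 : -Complex.I * (-(h : ℂ) / (2 * Real.pi * Complex.I)) = ((h / (2 * Real.pi) : ℝ) : ℂ) := by
    push_cast
    field_simp
  have e2 : -(Real.pi : ℂ) * Complex.I * ((u - -(h : ℂ) / 2) / (2 * Real.pi * Complex.I)) ^ 2 /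
      (-(h : ℂ) / (2 * Real.pi * Complex.I)) = (u + h / 2) ^ 2 / (2 * h) := by
    field_simp
    ring
  have e3 : (u - -(h : ℂ) / 2) / (2 * Real.pi * Complex.I) / (-(h : ℂ) / (2 * Real.pi * Complex.I)) =
      -(u + h / 2) / h := by
    field_simp
    ring
  have e4 : -1 / (-(h : ℂ) / (2 * Real.pi * Complex.I)) = 2 * Real.pi * Complex.I / h := by
    field_simp
  rw [e1, e2, e3, e4]

/-- Since `πn² - n Im v ≥ δ|n|`, the `n`-th term is at most `exp(-2πδ|n|/h)`, so only `n = 0`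
survives. Just `Im v` is controlled: `Re v` may be unbounded. -/
lemma tendsto_jacobiTheta₂_one {ι : Type*} {l : Filter ι} {h : ι → ℝ} {v : ι → ℂ} {δ : ℝ}
    (hδ : 0 < δ) (hh : Tendsto h l (𝓝[>] 0)) (hv : ∀ᶠ i in l, |(v i).im| ≤ Real.pi - δ) :
    Tendsto (fun i => jacobiTheta₂ (-v i / h i) (2 * Real.pi * Complex.I / h i)) l (𝓝 1) := by
  have hpi := Real.pi_pos
  have hh0 : ∀ᶠ i in l, 0 < h i := hh.eventually self_mem_nhdsWithin
  have hh1 : ∀ᶠ i in l, h i ≤ 1 :=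
    (hh.mono_right nhdsWithin_le_nhds).eventually_le_const one_pos
  have key : ∀ᶠ i in l, ∀ n : ℤ, ‖jacobiTheta₂_term n (-v i / h i) (2 * Real.pi * Complex.I / h i)‖ ≤
      Real.exp (-(2 * Real.pi * δ * |(n : ℝ)|) / h i) := by
    filter_upwards [hh0, hv] with i h0 hvi n
    rw [norm_jacobiTheta₂_term, Real.exp_le_exp]
    have i1 : (2 * Real.pi * Complex.I / h i : ℂ).im = 2 * Real.pi / h i := by
      rw [Complex.div_ofReal_im]
      simp
    have i2 : (-v i / h i : ℂ).im = -(v i).im / h i := by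
      rw [Complex.div_ofReal_im]
      simp
    rw [i1, i2]
    rw [show -Real.pi * (n : ℝ) ^ 2 * (2 * Real.pi / h i) - 2 * Real.pi * n * (-(v i).im / h i) =
      (-(2 * Real.pi * (Real.pi * n ^ 2 - n * (v i).im))) / h i by field_simp; ring]
    gcongr (-?_) / h i
    rw [mul_assoc (2 * Real.pi)]
    gcongr
    have h1 : (n : ℝ) * (v i).im ≤ |(n : ℝ)| * (Real.pi - δ) := by
      refine (le_abs_self _).trans ?_
      rw [abs_mul]
      gcongr
    have h2 : |(n : ℝ)| ≤ (n : ℝ) ^ 2 := by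
      rw [← sq_abs]
      rcases eq_or_ne n 0 with rfl | hn
      · simp
      · have : (1 : ℝ) ≤ |(n : ℝ)| := by exact_mod_cast Int.one_le_abs hn
        nlinarith
    nlinarith
  have hsum : Summable fun n : ℤ => Real.exp (-(2 * Real.pi * δ * |(n : ℝ)|)) := by
    have hg : Summable fun n : ℕ => Real.exp (-(2 * Real.pi * δ)) ^ n :=
      summable_geometric_of_lt_one (Real.exp_pos _).le (Real.exp_lt_one_iff.mpr (by
        have : 0 < 2 * Real.pi * δ := by positivity
        linarith))
    have hg' : Summable fun n : ℕ => Real.exp (-(2 * Real.pi * δ * (n : ℝ))) :=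
      hg.congr fun n => by rw [← Real.exp_nat_mul]; congr 1; ring
    exact Summable.of_nat_of_neg (by simpa using hg') (by simpa using hg')
  have hlim : ∀ n : ℤ, Tendsto
      (fun i => jacobiTheta₂_term n (-v i / h i) (2 * Real.pi * Complex.I / h i)) l
      (𝓝 (if n = 0 then 1 else 0)) := fun n => by
    split_ifs with hn
    · subst hn
      simpa [jacobiTheta₂_term] using tendsto_const_nhds
    · refine squeeze_zero_norm' (key.mono fun i hi => hi n) ?_
      refine Real.tendsto_exp_atBot.comp ?_
      have hc : 0 < 2 * Real.pi * δ * |(n : ℝ)| := by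
        have : 0 < |(n : ℝ)| := abs_pos.mpr (by exact_mod_cast hn)
        positivity
      have := (tendsto_inv_nhdsGT_zero.comp hh).const_mul_atTop_of_neg (neg_lt_zero.mpr hc)
      exact this
  have := tendsto_tsum_of_dominated_convergence hsum hlim (by
    filter_upwards [key, hh0, hh1] with i hi h0 h1 n
    refine (hi n).trans (Real.exp_le_exp.mpr ?_)
    rw [neg_div, neg_le_neg_iff, le_div_iff₀ h0]
    exact mul_le_of_le_one_right (by positivity) h1)
  rw [tsum_ite_eq] at this
  exact this

/-- The ratio `θ_q(q^β e^u) / θ_q(e^u)` is asymptotic to `e^{-βu}` in closed subsectors of the cut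
plane. -/
lemma tendsto_theta_ratio {ι : Type*} {l : Filter ι} {h : ι → ℝ} {u : ι → ℂ} {δ : ℝ} (β : ℂ)
    (hδ : 0 < δ) (hh : Tendsto h l (𝓝[>] 0)) (hu : ∀ᶠ i in l, |(u i).im| ≤ Real.pi - δ) :
    Tendsto (fun i => theta (Complex.exp (-h i)) (Complex.exp (u i - β * h i)) /
      theta (Complex.exp (-h i)) (Complex.exp (u i)) * Complex.exp (β * u i)) l (𝓝 1) := by
  have hh' : Tendsto h l (𝓝 0) := hh.mono_right nhdsWithin_le_nhds
  have hh0 : ∀ᶠ i in l, 0 < h i := hh.eventually self_mem_nhdsWithin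
  have hhc : Tendsto (fun i => (h i : ℂ)) l (𝓝 0) := by
    have := (Complex.continuous_ofReal.tendsto 0).comp hh'
    rwa [Complex.ofReal_zero] at this
  have hv1 : ∀ᶠ i in l, |(u i + h i / 2).im| ≤ Real.pi - δ := by
    filter_upwards [hu] with i hi
    have : ((h i : ℂ) / 2).im = 0 := by
      rw [show (h i : ℂ) / 2 = ((h i / 2 : ℝ) : ℂ) by push_cast; rfl, Complex.ofReal_im]
    rwa [Complex.add_im, this, add_zero]
  have hβ : ∀ᶠ i in l, |(β * h i).im| ≤ δ / 2 := by
    have : Tendsto (fun i => |(β * h i).im|) l (𝓝 |(β * 0).im|) :=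
      ((Complex.continuous_im.tendsto _).comp (hhc.const_mul β)).abs
    rw [mul_zero, Complex.zero_im, abs_zero] at this
    exact this.eventually_le_const (by positivity)
  -- Half of the margin `δ` pays for `Im(βh)`.
  have hv2 : ∀ᶠ i in l, |(u i - β * h i + h i / 2).im| ≤ Real.pi - δ / 2 := by
    filter_upwards [hv1, hβ] with i h1 h2
    rw [show u i - β * h i + h i / 2 = (u i + h i / 2) - β * h i by ring, Complex.sub_im]
    have := abs_sub (u i + h i / 2 : ℂ).im (β * h i).im
    linarith
  have t1 := tendsto_jacobiTheta₂_one hδ hh hv1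
  have t2 := tendsto_jacobiTheta₂_one (half_pos hδ) hh hv2
  have t3 : Tendsto (fun i => Complex.exp ((β ^ 2 - β) / 2 * h i)) l (𝓝 1) := by
    have := (hhc.const_mul ((β ^ 2 - β) / 2)).cexp
    rwa [mul_zero, Complex.exp_zero] at this
  have t := (t2.div t1 one_ne_zero).mul t3
  rw [div_one, one_mul] at t
  refine t.congr' ?_
  filter_upwards [hh0] with i h0
  have hne : (h i : ℂ) ≠ 0 := by exact_mod_cast h0.ne'
  have hc : ((h i / (2 * Real.pi) : ℝ) : ℂ) ^ (1 / 2 : ℂ) ≠ 0 := by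
    rw [Complex.cpow_ne_zero_iff_of_exponent_ne_zero (by norm_num)]
    have := Real.pi_pos
    exact_mod_cast (by positivity : h i / (2 * Real.pi) ≠ 0)
  rw [Pi.div_apply, theta_exp_eq h0, theta_exp_eq h0]
  -- The difference of the two Gaussian exponents is `-βu + (β² - β)h/2`.
  have hE : Complex.exp ((u i - β * h i + h i / 2) ^ 2 / (2 * h i)) =
      Complex.exp ((u i + h i / 2) ^ 2 / (2 * h i)) * Complex.exp ((β ^ 2 - β) / 2 * h i) *
        (Complex.exp (β * u i))⁻¹ := by
    rw [← Complex.exp_neg, ← Complex.exp_add, ← Complex.exp_add]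
    congr 1
    field_simp
    ring
  rw [hE]
  have := Complex.exp_ne_zero ((u i + h i / 2) ^ 2 / (2 * h i))
  have := Complex.exp_ne_zero (β * u i)
  field_simp

end thetaAsymptotics

/-! ### A second-order Taylor estimate -/

section taylor

lemma norm_sub_sub_mul_le {f f' f'' : ℂ → ℂ} {S : Set ℂ} {M : ℝ} (hS : Convex ℝ S)
    (hf : ∀ u ∈ S, HasDerivAt f (f' u) u) (hf' : ∀ u ∈ S, HasDerivAt f' (f'' u) u)
    (hM : ∀ u ∈ S, ‖f'' u‖ ≤ M) {x y : ℂ} (hx : x ∈ S) (hy : y ∈ S) :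
    ‖f y - f x - f' x * (y - x)‖ ≤ M * ‖y - x‖ ^ 2 := by
  have hM0 : 0 ≤ M := (norm_nonneg _).trans (hM x hx)
  have h1 : ∀ u ∈ S, ‖f' u - f' x‖ ≤ M * ‖u - x‖ := fun u hu =>
    hS.norm_image_sub_le_of_norm_hasDerivWithin_le
      (fun v hv => (hf' v hv).hasDerivWithinAt) hM hx hu
  have hseg : segment ℝ x y ⊆ S := hS.segment_subset hx hy
  have h2 := (convex_segment (𝕜 := ℝ) x y).norm_image_sub_le_of_norm_hasDerivWithin_le
    (f := fun u => f u - f' x * u) (f' := fun u => f' u - f' x) (C := M * ‖y - x‖)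
    (fun u hu => by
      have := ((hf u (hseg hu)).sub ((hasDerivAt_id u).const_mul (f' x))).hasDerivWithinAt
        (s := segment ℝ x y)
      rw [mul_one] at this
      exact this)
    (fun u hu => (h1 u (hseg hu)).trans (by
      gcongr
      exact norm_sub_le_of_mem_segment hu))
    (left_mem_segment ℝ x y) (right_mem_segment ℝ x y)
  calc ‖f y - f x - f' x * (y - x)‖ = ‖f y - f' x * y - (f x - f' x * x)‖ := by congr 1; ring
    _ ≤ M * ‖y - x‖ * ‖y - x‖ := h2
    _ = M * ‖y - x‖ ^ 2 := by ring

end taylor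

/-! ### Convergence of the `q`-Gamma function -/

section gamma

/-- The logarithm of the `q`-number `(1 - q^u) / h` for `q = e^{-h}`. -/
def logQNumber (h : ℝ) (u : ℂ) : ℂ := Complex.log ((1 - Complex.exp (-h * u)) / h)

variable {h : ℝ}

lemma norm_exp_neg_mul (h : ℝ) (u : ℂ) : ‖Complex.exp (-h * u)‖ = Real.exp (-(h * u.re)) := by
  rw [Complex.norm_exp]
  congr 1
  simp

lemma norm_exp_neg_mul_lt_one (hh : 0 < h) {u : ℂ} (hu : 0 < u.re) :
    ‖Complex.exp (-h * u)‖ < 1 := by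
  rw [norm_exp_neg_mul]
  exact Real.exp_lt_one_iff.mpr (neg_lt_zero.mpr (mul_pos hh hu))

lemma one_sub_exp_ne_zero (hh : 0 < h) {u : ℂ} (hu : 0 < u.re) :
    1 - Complex.exp (-h * u) ≠ 0 := by
  intro h0
  have := norm_exp_neg_mul_lt_one hh hu
  rw [← sub_eq_zero.mp h0, norm_one] at this
  exact lt_irrefl _ this

lemma qNumber_mem_slitPlane (hh : 0 < h) {u : ℂ} (hu : 0 < u.re) :
    (1 - Complex.exp (-h * u)) / h ∈ Complex.slitPlane := by
  refine Or.inl ?_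
  rw [Complex.div_ofReal_re]
  refine div_pos ?_ hh
  rw [Complex.sub_re, Complex.one_re, sub_pos]
  exact (Complex.re_le_norm _).trans_lt (norm_exp_neg_mul_lt_one hh hu)

lemma exp_logQNumber (hh : 0 < h) {u : ℂ} (hu : 0 < u.re) :
    Complex.exp (logQNumber h u) = (1 - Complex.exp (-h * u)) / h :=
  Complex.exp_log (Complex.slitPlane_ne_zero (qNumber_mem_slitPlane hh hu))

lemma hasDerivAt_one_sub_exp (h : ℝ) (u : ℂ) :
    HasDerivAt (fun u : ℂ => 1 - Complex.exp (-h * u)) (h * Complex.exp (-h * u)) u := by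
  have := (((hasDerivAt_id u).const_mul (-(h : ℂ))).cexp).const_sub 1
  simp only [id, mul_one] at this
  exact this.congr_deriv (by ring)

lemma hasDerivAt_logQNumber (hh : 0 < h) {u : ℂ} (hu : 0 < u.re) :
    HasDerivAt (logQNumber h) (h * Complex.exp (-h * u) / (1 - Complex.exp (-h * u))) u := by
  have hne := one_sub_exp_ne_zero hh hu
  have hh' : (h : ℂ) ≠ 0 := by exact_mod_cast hh.ne'
  have := ((hasDerivAt_one_sub_exp h u).div_const (h : ℂ)).clog (qNumber_mem_slitPlane hh hu)
  exact this.congr_deriv (by rw [div_div_div_cancel_right₀ hh'])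

lemma hasDerivAt_deriv_logQNumber (hh : 0 < h) {u : ℂ} (hu : 0 < u.re) :
    HasDerivAt (fun u : ℂ => h * Complex.exp (-h * u) / (1 - Complex.exp (-h * u)))
      (-(h ^ 2 * Complex.exp (-h * u) / (1 - Complex.exp (-h * u)) ^ 2)) u := by
  have hne := one_sub_exp_ne_zero hh hu
  have h1 := (((hasDerivAt_id u).const_mul (-(h : ℂ))).cexp).const_mul (h : ℂ)
  simp only [id, mul_one] at h1
  have := h1.div (hasDerivAt_one_sub_exp h u) hne
  exact this.congr_deriv (by rw [← neg_div]; congr 1; ring)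

/-- With `t = h Re u` the norm is at most `h²/(4 sinh²(t/2)) ≤ h²/t² = 1/(Re u)²`. Uniformity in `h`
is what permits dominated convergence. -/
lemma norm_deriv_deriv_logQNumber_le (hh : 0 < h) {u : ℂ} {m : ℝ} (hm : 0 < m) (hu : m ≤ u.re) :
    ‖-(h ^ 2 * Complex.exp (-h * u) / (1 - Complex.exp (-h * u)) ^ 2 : ℂ)‖ ≤ 1 / m ^ 2 := by
  have hσ : 0 < u.re := hm.trans_le hu
  set t := h * u.re with ht
  have ht0 : 0 < t := mul_pos hh hσ
  have h1 : 1 - Real.exp (-t) ≤ ‖1 - Complex.exp (-h * u)‖ := by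
    have := norm_sub_norm_le (1 : ℂ) (Complex.exp (-h * u))
    rwa [norm_one, norm_exp_neg_mul] at this
  have h2 : t * Real.exp (-t / 2) ≤ 1 - Real.exp (-t) := by
    have hs := Real.self_le_sinh_iff.mpr (half_pos ht0).le
    rw [Real.sinh_eq] at hs
    have e1 : Real.exp (t / 2) * Real.exp (-t / 2) = 1 := by rw [← Real.exp_add]; simp; ring
    have e2 : Real.exp (-(t / 2)) * Real.exp (-t / 2) = Real.exp (-t) := by
      rw [← Real.exp_add]; congr 1; ring
    have := mul_le_mul_of_nonneg_right hs (Real.exp_pos (-t / 2)).le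
    nlinarith
  have h3 : 0 < t * Real.exp (-t / 2) := by positivity
  have h4 : t ^ 2 * Real.exp (-t) ≤ ‖1 - Complex.exp (-h * u)‖ ^ 2 := by
    have e : t ^ 2 * Real.exp (-t) = (t * Real.exp (-t / 2)) ^ 2 := by
      rw [mul_pow t, ← Real.exp_nat_mul]; congr 2; push_cast; ring
    rw [e]
    gcongr
    exact h2.trans h1
  have h5 : 0 < ‖1 - Complex.exp (-h * u)‖ := norm_pos_iff.mpr (one_sub_exp_ne_zero hh hσ)
  rw [norm_neg, norm_div, norm_mul, norm_pow, norm_pow, norm_exp_neg_mul, Complex.norm_real,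
    Real.norm_of_nonneg hh.le, div_le_div_iff₀ (by positivity) (by positivity), one_mul, ← ht]
  calc h ^ 2 * Real.exp (-t) * m ^ 2 ≤ h ^ 2 * Real.exp (-t) * u.re ^ 2 := by gcongr
    _ = t ^ 2 * Real.exp (-t) := by rw [ht]; ring
    _ ≤ _ := h4

/-- The logarithms of the factors in the product expansion of the `q`-Gamma function. -/
def gammaTerm (g : ℂ → ℂ) (s : ℂ) (n : ℕ) : ℂ :=
  g (n + 1) - g (n + 1 + s) + s * (g (n + 1 + 1) - g (n + 1))

lemma norm_gammaTerm_logQNumber_le (hh : 0 < h) {s : ℂ} (hs : 0 < s.re) (n : ℕ) :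
    ‖gammaTerm (logQNumber h) s n‖ ≤ (‖s‖ ^ 2 + ‖s‖) * (1 / ((n : ℝ) + 1) ^ 2) := by
  have hm : (0 : ℝ) < n + 1 := by positivity
  have hS : Convex ℝ {u : ℂ | (n + 1 : ℝ) ≤ u.re} := convex_halfSpace_re_ge _
  have key : ∀ y : ℂ, (n + 1 : ℝ) ≤ y.re → _ := fun y hy => norm_sub_sub_mul_le hS
    (fun u hu => hasDerivAt_logQNumber hh (hm.trans_le hu))
    (fun u hu => hasDerivAt_deriv_logQNumber hh (hm.trans_le hu))
    (fun u hu => norm_deriv_deriv_logQNumber_le hh hm hu)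
    (x := (n + 1 : ℂ)) (y := y) (by simp) hy
  have k1 := key (n + 1 + s) (by simp [hs.le])
  have k2 := key (n + 1 + 1) (by simp)
  rw [add_sub_cancel_left] at k1 k2
  -- `D` is the derivative at `n + 1`; its contributions cancel, so `gammaTerm` consists of
  -- second-order remainders.
  set D := (h * Complex.exp (-h * (n + 1 : ℂ)) / (1 - Complex.exp (-h * (n + 1 : ℂ))) : ℂ)
  have e : gammaTerm (logQNumber h) s n =
      s * (logQNumber h (n + 1 + 1) - logQNumber h (n + 1) - D * 1) -
        (logQNumber h (n + 1 + s) - logQNumber h (n + 1) - D * s) := by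
    rw [gammaTerm]
    ring
  rw [e]
  refine (norm_sub_le _ _).trans ?_
  rw [norm_mul]
  rw [norm_one, one_pow, mul_one (1 / _)] at k2
  have := mul_le_mul_of_nonneg_left k2 (norm_nonneg s)
  linarith

lemma summable_gammaBound (s : ℂ) :
    Summable fun n : ℕ => (‖s‖ ^ 2 + ‖s‖) * (1 / ((n : ℝ) + 1) ^ 2) := by
  refine Summable.mul_left _ ?_
  have := (summable_nat_add_iff 1).mpr (Real.summable_one_div_nat_pow.mpr one_lt_two)
  simpa using this

lemma tendsto_one_sub_exp_div {s : ℂ} :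
    Tendsto (fun h : ℝ => (1 - Complex.exp (-h * s)) / h) (𝓝[>] 0) (𝓝 s) := by
  have h1 : HasDerivAt (fun h : ℝ => 1 - Complex.exp (-h * s)) s 0 := by
    have h0 : HasDerivAt (fun h : ℂ => 1 - Complex.exp (-h * s)) s ((0 : ℝ) : ℂ) := by
      have := ((((hasDerivAt_id ((0 : ℝ) : ℂ)).neg).mul_const s).cexp).const_sub 1
      simpa using this
    exact h0.comp_ofReal
  have h2 := h1.tendsto_slope_zero_right
  refine h2.congr fun t => ?_
  simp [div_eq_inv_mul]

lemma tendsto_logQNumber {u : ℂ} (hu : 0 < u.re) :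
    Tendsto (fun h : ℝ => logQNumber h u) (𝓝[>] 0) (𝓝 (Complex.log u)) :=
  (tendsto_one_sub_exp_div (s := u)).clog (Or.inl hu)

lemma tendsto_gammaTerm {s : ℂ} (hs : 0 < s.re) (n : ℕ) :
    Tendsto (fun h : ℝ => gammaTerm (logQNumber h) s n) (𝓝[>] 0)
      (𝓝 (gammaTerm Complex.log s n)) := by
  have t0 := tendsto_logQNumber (u := n + 1) (by simp; positivity)
  have t1 := tendsto_logQNumber (u := n + 1 + s) (by simp; positivity)
  have t2 := tendsto_logQNumber (u := n + 1 + 1) (by simp; positivity)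
  exact (t0.sub t1).add ((t2.sub t0).const_mul s)

lemma tendsto_tsum_gammaTerm {s : ℂ} (hs : 0 < s.re) :
    Tendsto (fun h : ℝ => ∑' n, gammaTerm (logQNumber h) s n) (𝓝[>] 0)
      (𝓝 (∑' n, gammaTerm Complex.log s n)) := by
  refine tendsto_tsum_of_dominated_convergence (summable_gammaBound s) (tendsto_gammaTerm hs) ?_
  filter_upwards [self_mem_nhdsWithin] with h hh n
  exact norm_gammaTerm_logQNumber_le hh hs n

/-- The bound for `logQNumber h` is uniform in `h`, so it passes to the limit. -/
lemma summable_gammaTerm_log {s : ℂ} (hs : 0 < s.re) : Summable (gammaTerm Complex.log s) := by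
  refine Summable.of_norm_bounded (summable_gammaBound s) fun n => ?_
  refine le_of_tendsto (tendsto_gammaTerm hs n).norm ?_
  filter_upwards [self_mem_nhdsWithin] with h hh
  exact norm_gammaTerm_logQNumber_le hh hs n

lemma sum_gammaTerm (g : ℂ → ℂ) (s : ℂ) (N : ℕ) :
    ∑ n ∈ Finset.range N, gammaTerm g s n =
      ∑ n ∈ Finset.range N, g (n + 1) - ∑ n ∈ Finset.range N, g (n + 1 + s) +
        s * (g (N + 1) - g 1) := by
  have := Finset.sum_range_sub (fun n : ℕ => g (n + 1)) N
  push_cast at this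
  rw [zero_add] at this
  simp only [gammaTerm]
  rw [Finset.sum_add_distrib, Finset.sum_sub_distrib, ← Finset.mul_sum, this]

lemma exp_sum_gammaTerm (g : ℂ → ℂ) (s : ℂ) (N : ℕ) :
    Complex.exp (∑ n ∈ Finset.range N, gammaTerm g s n) =
      (∏ n ∈ Finset.range N, Complex.exp (g (n + 1))) /
        (∏ n ∈ Finset.range N, Complex.exp (g (n + 1 + s))) *
        Complex.exp (s * (g (N + 1) - g 1)) := by
  rw [sum_gammaTerm, Complex.exp_add, Complex.exp_sub, Complex.exp_sum, Complex.exp_sum]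

lemma exp_tsum_gammaTerm_log {s : ℂ} (hs : 0 < s.re) :
    Complex.exp (∑' n, gammaTerm Complex.log s n) = Complex.Gamma (s + 1) := by
  have hs0 : s ≠ 0 := fun h0 => by simp [h0] at hs
  have t1 := ((summable_gammaTerm_log hs).hasSum.tendsto_sum_nat).cexp
  refine tendsto_nhds_unique t1 ?_
  -- The partial products carry `(N+1)^s` and no factor `s` in the denominator, whereas `GammaSeq`
  -- has `N^s` and that factor. Hence this correction and the multiplication by `s`.
  have t2 : Tendsto (fun N : ℕ => Complex.exp (s * ((Real.log (N + 1) - Real.log N : ℝ) : ℂ))) atTop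
      (𝓝 1) := by
    have := ((Complex.continuous_ofReal.tendsto 0).comp
      Real.tendsto_log_nat_add_one_sub_log).const_mul s
    rw [Complex.ofReal_zero, mul_zero] at this
    have := this.cexp
    rwa [Complex.exp_zero] at this
  have t3 := ((Complex.GammaSeq_tendsto_Gamma s).const_mul s).mul t2
  rw [mul_one, ← Complex.Gamma_add_one s hs0] at t3
  refine t3.congr' ?_
  filter_upwards [eventually_gt_atTop 0] with N hN
  have hN' : (N : ℂ) ≠ 0 := by exact_mod_cast hN.ne'
  rw [exp_sum_gammaTerm, Complex.GammaSeq, Finset.prod_range_succ', Nat.cast_zero, add_zero]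
  have p1 : ∏ n ∈ Finset.range N, Complex.exp (Complex.log ((n : ℂ) + 1)) = (N.factorial : ℂ) := by
    rw [← Finset.prod_range_add_one_eq_factorial]
    push_cast
    exact Finset.prod_congr rfl fun n _ => Complex.exp_log (Nat.cast_add_one_ne_zero n)
  have p2 : ∏ n ∈ Finset.range N, Complex.exp (Complex.log ((n : ℂ) + 1 + s)) =
      ∏ n ∈ Finset.range N, (s + ((n + 1 : ℕ) : ℂ)) := by
    refine Finset.prod_congr rfl fun n _ => ?_
    rw [Complex.exp_log]
    · push_cast; ring
    · intro h0
      have := congrArg Complex.re h0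
      simp at this
      have : (0 : ℝ) ≤ n := Nat.cast_nonneg n
      linarith
  have p3 : (N : ℂ) ^ s * Complex.exp (s * ((Real.log (N + 1) - Real.log N : ℝ) : ℂ)) =
      Complex.exp (s * (Complex.log (N + 1) - Complex.log 1)) := by
    rw [Complex.cpow_def_of_ne_zero hN', ← Complex.exp_add, Complex.log_one]
    have e1 : Complex.log (N + 1) = ((Real.log (N + 1) : ℝ) : ℂ) := by
      rw [Complex.ofReal_log (by positivity)]
      push_cast
      rfl
    have e2 : Complex.log N = ((Real.log N : ℝ) : ℂ) := by
      rw [Complex.ofReal_log (by positivity)]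
      push_cast
      rfl
    rw [e1, e2]
    push_cast
    congr 1
    ring
  rw [p1, p2, ← p3]
  field_simp

lemma norm_exp_neg_lt_one (hh : 0 < h) : ‖Complex.exp (-h)‖ < 1 := by
  simpa using norm_exp_neg_mul_lt_one hh (u := 1) (by simp)

lemma prod_exp_logQNumber (hh : 0 < h) {s : ℂ} (hs : 0 ≤ s.re) (N : ℕ) :
    ∏ n ∈ Finset.range N, Complex.exp (logQNumber h (n + 1 + s)) =
      (∏ n ∈ Finset.range N, (1 - Complex.exp (-h * (s + 1)) * Complex.exp (-h) ^ n)) / (h : ℂ) ^ N := by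
  have : ∀ n ∈ Finset.range N, Complex.exp (logQNumber h (n + 1 + s)) =
      (1 - Complex.exp (-h * (s + 1)) * Complex.exp (-h) ^ n) / h := fun n _ => by
    rw [exp_logQNumber hh (by simp; positivity), ← Complex.exp_nat_mul, ← Complex.exp_add]
    congr 3
    ring
  rw [Finset.prod_congr rfl this, Finset.prod_div_distrib, Finset.prod_const, Finset.card_range]

lemma logQNumber_ofReal (hh : 0 < h) {t : ℝ} (ht : 0 < t) :
    logQNumber h t = ((Real.log (1 - Real.exp (-h * t)) - Real.log h : ℝ) : ℂ) := by
  have h1 : 0 < 1 - Real.exp (-h * t) := by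
    rw [sub_pos, Real.exp_lt_one_iff]
    nlinarith
  rw [← Real.log_div h1.ne' hh.ne', logQNumber, Complex.ofReal_log (by positivity)]
  push_cast
  rfl

lemma exp_tsum_gammaTerm_logQNumber (hh : 0 < h) {s : ℂ} (hs : 0 < s.re) :
    Complex.exp (∑' n, gammaTerm (logQNumber h) s n) =
      qInf (Complex.exp (-h)) (Complex.exp (-h)) /
        qInf (Complex.exp (-h)) (Complex.exp (-h * (s + 1))) *
        Complex.exp (-s * Real.log (1 - Real.exp (-h))) := by
  have hq := norm_exp_neg_lt_one hh
  have hsum : Summable (gammaTerm (logQNumber h) s) :=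
    Summable.of_norm_bounded (summable_gammaBound s) (norm_gammaTerm_logQNumber_le hh hs)
  refine tendsto_nhds_unique (hsum.hasSum.tendsto_sum_nat).cexp ?_
  have hQ : qInf (Complex.exp (-h)) (Complex.exp (-h * (s + 1))) ≠ 0 :=
    qInf_ne_zero_of_norm_lt_one hq (norm_exp_neg_mul_lt_one hh (by simp; linarith))
  have t1 := (tendsto_prod_qInf hq (Complex.exp (-h))).div (tendsto_prod_qInf hq _) hQ
  have t2 : Tendsto (fun N : ℕ => Complex.exp (s * (logQNumber h (N + 1) - logQNumber h 1))) atTop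
      (𝓝 (Complex.exp (-s * Real.log (1 - Real.exp (-h))))) := by
    have l1 : Tendsto (fun N : ℕ => Real.log (1 - Real.exp (-h * ((N : ℝ) + 1)))) atTop (𝓝 0) := by
      have a1 : Tendsto (fun N : ℕ => -h * ((N : ℝ) + 1)) atTop atBot :=
        (tendsto_atTop_add_const_right _ 1 tendsto_natCast_atTop_atTop).const_mul_atTop_of_neg
          (neg_lt_zero.mpr hh)
      have a2 := (Real.tendsto_exp_atBot.comp a1).const_sub 1
      rw [sub_zero] at a2
      have := (Real.continuousAt_log one_ne_zero).tendsto.comp a2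
      rwa [Real.log_one] at this
    have l2 := ((Complex.continuous_ofReal.tendsto _).comp
      (l1.sub_const (Real.log (1 - Real.exp (-h))))).const_mul s
    rw [zero_sub] at l2
    have l3 := l2.cexp
    rw [show s * ((-Real.log (1 - Real.exp (-h)) : ℝ) : ℂ) = -s * Real.log (1 - Real.exp (-h)) by
      push_cast; ring] at l3
    refine l3.congr fun N => ?_
    have e1 := logQNumber_ofReal hh (t := (N : ℝ) + 1) (by positivity)
    have e2 := logQNumber_ofReal hh (t := 1) one_pos
    rw [mul_one] at e2
    push_cast at e1 e2
    rw [e1, e2]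
    simp only [Function.comp]
    push_cast
    congr 2
    ring
  refine (t1.mul t2).congr fun N => ?_
  have hN : (h : ℂ) ^ N ≠ 0 := pow_ne_zero _ (by exact_mod_cast hh.ne')
  have p0 := prod_exp_logQNumber hh (s := 0) (by simp) N
  simp only [add_zero, zero_add, mul_one] at p0
  rw [exp_sum_gammaTerm, prod_exp_logQNumber hh hs.le, p0, Pi.div_apply]
  congr 1
  field_simp

/-- The `q`-Gamma function `(q; q)_∞ / (q^s; q)_∞ (1 - q)^{1-s}` for `q = e^{-h}`. -/
def qGamma (h : ℝ) (s : ℂ) : ℂ :=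
  qInf (Complex.exp (-h)) (Complex.exp (-h)) / qInf (Complex.exp (-h)) (Complex.exp (-h * s)) *
    Complex.exp ((1 - s) * Real.log (1 - Real.exp (-h)))

lemma tendsto_qGamma_add_one {s : ℂ} (hs : 0 < s.re) :
    Tendsto (fun h : ℝ => qGamma h (s + 1)) (𝓝[>] 0) (𝓝 (Complex.Gamma (s + 1))) := by
  have t := (tendsto_tsum_gammaTerm hs).cexp
  rw [exp_tsum_gammaTerm_log hs] at t
  refine t.congr' ?_
  filter_upwards [self_mem_nhdsWithin] with h hh
  rw [exp_tsum_gammaTerm_logQNumber hh hs, qGamma, show (1 : ℂ) - (s + 1) = -s by ring]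

lemma qGamma_eq (hh : 0 < h) (s : ℂ) :
    qGamma h s = (1 - Complex.exp (-h)) / (1 - Complex.exp (-h * s)) * qGamma h (s + 1) := by
  have h1 : 0 < 1 - Real.exp (-h) := by
    rw [sub_pos, Real.exp_lt_one_iff]
    linarith
  have e1 : Complex.exp ((1 - s) * Real.log (1 - Real.exp (-h))) =
      (1 - Complex.exp (-h)) * Complex.exp ((1 - (s + 1)) * Real.log (1 - Real.exp (-h))) := by
    have : (1 - Complex.exp (-h) : ℂ) = Complex.exp (Real.log (1 - Real.exp (-h))) := by
      rw [← Complex.ofReal_exp, Real.exp_log h1]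
      push_cast
      rfl
    rw [this, ← Complex.exp_add]
    congr 1
    ring
  rw [qGamma, qGamma, qInf_eq_one_sub_mul (norm_exp_neg_lt_one hh) (Complex.exp (-h * s)),
    ← Complex.exp_add, e1, show -(h : ℂ) + -h * s = -h * (s + 1) by ring]
  generalize Complex.exp (-h * s) = A
  rw [← div_div]
  ring

/-- The `q`-Gamma function tends to the Gamma function. -/
theorem tendsto_qGamma {s : ℂ} (hs : ∀ k : ℕ, s ≠ -k) :
    Tendsto (fun h : ℝ => qGamma h s) (𝓝[>] 0) (𝓝 (Complex.Gamma s)) := by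
  -- `m` counts the uses of the functional equation needed to reach `Re s > 1`.
  obtain ⟨m, hm⟩ := exists_nat_gt (1 - s.re)
  induction m generalizing s with
  | zero =>
    have := tendsto_qGamma_add_one (s := s - 1) (by
      rw [Complex.sub_re, Complex.one_re]
      push_cast at hm
      linarith)
    rwa [sub_add_cancel] at this
  | succ m ih =>
    have hs0 : s ≠ 0 := by simpa using hs 0
    have t := ih (s := s + 1) (fun k h => hs (k + 1) (by push_cast; linear_combination h)) (by
      rw [Complex.add_re, Complex.one_re]
      push_cast at hm
      linarith)
    have t1 := (tendsto_one_sub_exp_div (s := 1)).div (tendsto_one_sub_exp_div (s := s)) hs0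
    have t2 := t1.mul t
    rw [Complex.Gamma_add_one s hs0, ← mul_assoc, one_div, inv_mul_cancel₀ hs0, one_mul] at t2
    refine t2.congr' ?_
    filter_upwards [self_mem_nhdsWithin] with h hh
    have hh' : (h : ℂ) ≠ 0 := by exact_mod_cast (ne_of_gt hh)
    rw [qGamma_eq hh s, Pi.div_apply, mul_one, div_div_div_cancel_right₀ hh']

end gamma

/-! ### Assembling the limit -/

section limit

lemma tendsto_neg_log_nhdsLT_one : Tendsto (fun q : ℝ => -Real.log q) (𝓝[<] 1) (𝓝[>] 0) := by
  refine tendsto_nhdsWithin_iff.mpr ⟨?_, ?_⟩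
  · have := (Real.continuousAt_log one_ne_zero).tendsto.neg
    rw [Real.log_one, neg_zero] at this
    exact this.mono_left nhdsWithin_le_nhds
  · filter_upwards [eventually_mem_Ioo_nhdsLT_one] with q hq
    exact neg_pos.mpr (Real.log_neg hq.1 hq.2)

lemma ofReal_eq_exp {q : ℝ} (hq : 0 < q) : (q : ℂ) = Complex.exp (-((-Real.log q : ℝ) : ℂ)) := by
  rw [← Complex.ofReal_neg, neg_neg, ← Complex.ofReal_exp, Real.exp_log hq]

lemma ofReal_cpow_eq_exp {q : ℝ} (hq : 0 < q) (α : ℂ) :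
    (q : ℂ) ^ α = Complex.exp (-(α * ((-Real.log q : ℝ) : ℂ))) := by
  rw [Complex.cpow_def_of_ne_zero (by exact_mod_cast hq.ne'), ← Complex.ofReal_log hq.le]
  congr 1
  push_cast
  ring

lemma tendsto_ofReal_cpow (α : ℂ) :
    Tendsto (fun q : ℝ => (q : ℂ) ^ α) (𝓝[<] 1) (𝓝 1) := by
  have h : ContinuousAt (fun z : ℂ => z ^ α) 1 :=
    continuousAt_id.cpow continuousAt_const (by simp)
  have := h.tendsto.comp tendsto_ofReal_nhdsLT_one
  rwa [Complex.one_cpow] at this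

/-- For non-real `α`, equality may occur at some `q`, through the period `2πi` of `exp`. Once `|Im α
· log q| < π`, injectivity of `exp` on the strip forces `α = k + 1`, for all `k` at once. -/
lemma eventually_cpow_ne_pow {α : ℂ} (hα : ∀ k : ℕ, α ≠ (k : ℂ) + 1) :
    ∀ᶠ q : ℝ in 𝓝[<] 1, ∀ k : ℕ, (q : ℂ) ^ α ≠ (q : ℂ) ^ (k + 1) := by
  have hlim : Tendsto (fun q : ℝ => |α.im * (-Real.log q)|) (𝓝[<] 1) (𝓝 0) := by
    have := ((tendsto_neg_log_nhdsLT_one.mono_right nhdsWithin_le_nhds).const_mul α.im).abs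
    rwa [mul_zero, abs_zero] at this
  filter_upwards [eventually_mem_Ioo_nhdsLT_one, hlim.eventually_lt_const Real.pi_pos] with q hq him k
  intro h
  have hlog : (Real.log q : ℂ) ≠ 0 := by
    exact_mod_cast (Real.log_neg hq.1 hq.2).ne
  have hk : (q : ℂ) ^ (k + 1) = Complex.exp ((((k : ℝ) + 1) * Real.log q : ℝ) : ℂ) := by
    rw [← Complex.ofReal_exp, mul_comm, ← Real.rpow_def_of_pos hq.1]
    norm_cast
  rw [ofReal_cpow_eq_exp hq.1, hk] at h
  have i1 : (-(α * ((-Real.log q : ℝ) : ℂ))).im = -(α.im * (-Real.log q)) := by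
    rw [Complex.neg_im, Complex.im_mul_ofReal]
  have hb := abs_lt.mp him
  have := Complex.exp_inj_of_neg_pi_lt_of_le_pi (by rw [i1]; linarith) (by rw [i1]; linarith)
    (by rw [Complex.ofReal_im]; linarith [Real.pi_pos]) (by rw [Complex.ofReal_im]; exact Real.pi_pos.le) h
  apply hα k
  apply mul_right_cancel₀ hlog
  push_cast at this
  linear_combination this

lemma abs_arg_lt_pi {z : ℂ} (hz : z ∈ Complex.slitPlane) : |z.arg| < Real.pi :=
  abs_lt.mpr ⟨Complex.neg_pi_lt_arg z,
    (Complex.arg_le_pi z).lt_of_ne (Complex.mem_slitPlane_iff_arg.mp hz).1⟩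

lemma inv_mem_slitPlane {z : ℂ} (hz : z ∈ Complex.slitPlane) : z⁻¹ ∈ Complex.slitPlane := by
  have h0 : 0 < Complex.normSq z := Complex.normSq_pos.mpr (Complex.slitPlane_ne_zero hz)
  rw [Complex.mem_slitPlane_iff] at hz ⊢
  rw [Complex.inv_re, Complex.inv_im]
  rcases hz with h | h
  · exact Or.inl (div_pos h h0)
  · exact Or.inr (div_ne_zero (neg_ne_zero.mpr h) h0.ne')

variable {α lam x : ℂ}

lemma tendsto_one_div_cpow_mul (hx : x ≠ 0) :
    Tendsto (fun q : ℝ => 1 / ((q : ℂ) ^ α * x)) (𝓝[<] 1) (𝓝 (1 / x)) := by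
  have := ((tendsto_ofReal_cpow α).mul_const x)
  rw [one_mul] at this
  exact tendsto_const_nhds.div this hx

lemma one_div_mul_div (a x c : ℂ) : 1 / (a * (x / c)) = 1 / (a * x) * c := by
  rw [← mul_div_assoc, one_div_div, one_div, div_eq_inv_mul]

lemma eventually_norm_one_div_lt_one (α : ℂ) (hx : x ≠ 0) :
    ∀ᶠ q : ℝ in 𝓝[<] 1, ‖1 / ((q : ℂ) ^ α * (x / (1 - (q : ℂ))))‖ < 1 := by
  have h := (tendsto_one_div_cpow_mul (α := α) hx).mul (tendsto_ofReal_nhdsLT_one.const_sub 1)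
  rw [sub_self, mul_zero] at h
  have h2 := h.norm
  rw [norm_zero] at h2
  filter_upwards [h2.eventually_lt_const one_pos] with q hq
  rwa [one_div_mul_div]

lemma div_rescaled_eq {q : ℝ} (lam x : ℂ) :
    lam / (x / (1 - (q : ℂ))) = (x / lam)⁻¹ * ((1 - q : ℝ) : ℂ) := by
  rw [inv_div, div_div_eq_mul_div]
  push_cast
  ring

lemma div_rescaled_mem_slitPlane {q : ℝ} (hq : q < 1) (hx : x / lam ∈ Complex.slitPlane) :
    lam / (x / (1 - (q : ℂ))) ∈ Complex.slitPlane := by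
  rw [div_rescaled_eq]
  exact mul_ofReal_mem_slitPlane (inv_mem_slitPlane hx) (sub_pos.mpr hq)

/-- The regularity of the objects entering the Laplace transform. -/
lemma eventually_laplace_regular (hα : ∀ k : ℕ, α ≠ (k : ℂ) + 1) (hlam : lam ∈ Complex.slitPlane)
    (hx : x ≠ 0) (hxlam : x / lam ∈ Complex.slitPlane) :
    ∀ᶠ q : ℝ in 𝓝[<] 1,
      IsMeromorphicSum (qBorel (q : ℂ) (psi10Coeff ((q : ℂ) ^ α) (q : ℂ)))
          (psiB ((q : ℂ) ^ α) (q : ℂ)) ∧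
        (∀ n : ℤ, AnalyticAt ℂ (psiB ((q : ℂ) ^ α) (q : ℂ)) (lam * (q : ℂ) ^ n) ∧
          theta (q : ℂ) (lam * (q : ℂ) ^ n / (x / (1 - (q : ℂ)))) ≠ 0) ∧
        Summable (qLaplaceTerm (q : ℂ) lam (psiB ((q : ℂ) ^ α) (q : ℂ)) (x / (1 - (q : ℂ)))) := by
  filter_upwards [eventually_mem_Ioo_nhdsLT_one, eventually_cpow_ne_pow hα,
    eventually_norm_one_div_lt_one α hx] with q hq ha hax
  have hq0' : (q : ℂ) ≠ 0 := by exact_mod_cast hq.1.ne'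
  have hqn := norm_ofReal_lt_one hq.1 hq.2
  have ha0 : (q : ℂ) ^ α ≠ 0 := by
    rw [ofReal_cpow_eq_exp hq.1]
    exact Complex.exp_ne_zero _
  have hs := div_rescaled_mem_slitPlane hq.2 hxlam
  refine ⟨isMeromorphicSum_psiB hq0' hqn ha0 ha, fun n => ⟨?_, theta_laplace_ne_zero hq.1 hq.2 hs n⟩,
    (hasSum_qLaplaceTerm_psiB hq.1 hq.2 ha0 ha hlam hs hax).summable⟩
  have hn := ofReal_zpow_mem hq.1 hlam n
  exact (analyticAt_borelClosed hq0' hqn ha0 ha (Complex.slitPlane_ne_zero hn)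
    (qInf_neg_ne_zero hq.1 hq.2 hn)).congr (psiB_eventuallyEq hq.1 hq.2 ha0 ha hn).symm

/-- The `q`-Borel-Laplace transform in terms of functions with known limits. -/
lemma psiTildeB_eq {q : ℝ} (hq0 : 0 < q) (hq1 : q < 1)
    (ha : ∀ k : ℕ, (q : ℂ) ^ α ≠ (q : ℂ) ^ (k + 1)) (hlam : lam ∈ Complex.slitPlane)
    (hxlam : x / lam ∈ Complex.slitPlane)
    (hax : ‖1 / ((q : ℂ) ^ α * (x / (1 - (q : ℂ))))‖ < 1) {h : ℝ} (hh : h = -Real.log q) {u : ℂ}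
    (hu : u = -Complex.log (x / lam) + Real.log (1 - q)) :
    psiTildeB ((q : ℂ) ^ α) q lam (x / (1 - (q : ℂ))) =
      qGamma h (1 - α) *
        (theta (Complex.exp (-h)) (Complex.exp (Complex.log lam - α * h)) /
          theta (Complex.exp (-h)) (Complex.exp (Complex.log lam)) *
            Complex.exp (α * Complex.log lam)) *
        (theta (Complex.exp (-h)) (Complex.exp (u - -α * h)) /
          theta (Complex.exp (-h)) (Complex.exp u) * Complex.exp (-α * u)) *
        powFrom lam x (-α) / qInf q (1 / ((q : ℂ) ^ α * x) * (1 - q)) := by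
  have hqe : Complex.exp (-h) = (q : ℂ) := by rw [hh]; exact (ofReal_eq_exp hq0).symm
  have hqr : Real.exp (-h) = q := by rw [hh, neg_neg, Real.exp_log hq0]
  have hae : (q : ℂ) ^ α = Complex.exp (-(α * h)) := by rw [hh]; exact ofReal_cpow_eq_exp hq0 α
  have ha0 : (q : ℂ) ^ α ≠ 0 := by rw [hae]; exact Complex.exp_ne_zero _
  have h1q : 0 < 1 - q := sub_pos.mpr hq1
  have hs := div_rescaled_mem_slitPlane hq1 hxlam
  have hue : lam / (x / (1 - (q : ℂ))) = Complex.exp u := by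
    rw [hu, Complex.exp_add, ← Complex.ofReal_exp, Real.exp_log h1q, Complex.exp_neg,
      Complex.exp_log (Complex.slitPlane_ne_zero hxlam), div_rescaled_eq]
  have e1 : (q : ℂ) / (q : ℂ) ^ α = Complex.exp (-h * (1 - α)) := by
    rw [hae]
    nth_rewrite 1 [← hqe]
    rw [← Complex.exp_sub]
    congr 1
    ring
  have e2 : (q : ℂ) ^ α * lam = Complex.exp (Complex.log lam - α * h) := by
    rw [sub_eq_add_neg, Complex.exp_add, ← hae, Complex.exp_log (Complex.slitPlane_ne_zero hlam),
      mul_comm]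
  have e3 : Complex.exp u / (q : ℂ) ^ α = Complex.exp (u - -α * h) := by
    rw [hae, ← Complex.exp_sub]
    congr 1
    ring
  -- The normalising factors of the `q`-Gamma function and of both theta ratios cancel against
  -- `x^(-α)`. The branch in `powFrom` is the one given by these two logarithms.
  have hexp : Complex.exp (α * Real.log (1 - q)) * Complex.exp (α * Complex.log lam) *
      Complex.exp (-α * u) * powFrom lam x (-α) = 1 := by
    rw [powFrom, ← Complex.exp_add, ← Complex.exp_add, ← Complex.exp_add, hu, ← Complex.exp_zero]
    congr 1
    ring
  rw [psiTildeB, qLaplace, (hasSum_qLaplaceTerm_psiB hq0 hq1 ha0 ha hlam hs hax).tsum_eq, hue,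
    one_div_mul_div, e1, e2, e3, qGamma, hqr, hqe, Complex.exp_log (Complex.slitPlane_ne_zero hlam),
    sub_sub_cancel]
  linear_combination -(qInf q q / qInf q (Complex.exp (-h * (1 - α))) *
    (theta q (Complex.exp (Complex.log lam - α * h)) / theta q lam) *
    (theta q (Complex.exp (u - -α * h)) / theta q (Complex.exp u)) /
    qInf q (1 / ((q : ℂ) ^ α * x) * (1 - q))) * hexp

theorem tendsto_psiTildeB (hα : ∀ k : ℕ, α ≠ (k : ℂ) + 1) (hlam : lam ∈ Complex.slitPlane)
    (hx : x ≠ 0) (hxlam : x / lam ∈ Complex.slitPlane) :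
    Tendsto (fun q : ℝ => psiTildeB ((q : ℂ) ^ α) (q : ℂ) lam (x / (1 - (q : ℂ)))) (𝓝[<] 1)
      (𝓝 (Complex.Gamma (1 - α) * powFrom lam x (-α) * Complex.exp (1 / x))) := by
  have hh := tendsto_neg_log_nhdsLT_one
  have t1 := (tendsto_qGamma (s := 1 - α) (fun k h => hα k (by linear_combination -h))).comp hh
  have t2 := tendsto_theta_ratio (u := fun _ : ℝ => Complex.log lam) α
    (sub_pos.mpr (abs_arg_lt_pi hlam)) hh
    (Eventually.of_forall fun _ => by rw [Complex.log_im]; linarith)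
  -- Here `Re u → -∞`, but `Im u = -arg(x/λ)` stays fixed, strictly inside `(-π, π)`.
  have t3 := tendsto_theta_ratio
    (u := fun q : ℝ => -Complex.log (x / lam) + Real.log (1 - q)) (-α)
    (sub_pos.mpr (abs_arg_lt_pi hxlam)) hh
    (Eventually.of_forall fun _ => by
      rw [Complex.add_im, Complex.ofReal_im, add_zero, Complex.neg_im, abs_neg, Complex.log_im]
      linarith)
  have t4 := tendsto_qInf_exp (tendsto_one_div_cpow_mul (α := α) hx)
  have t := (((t1.mul t2).mul t3).mul_const (powFrom lam x (-α))).div t4 (Complex.exp_ne_zero _)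
  rw [mul_one, mul_one, Complex.exp_neg, div_inv_eq_mul] at t
  refine t.congr' ?_
  filter_upwards [eventually_mem_Ioo_nhdsLT_one, eventually_cpow_ne_pow hα,
    eventually_norm_one_div_lt_one α hx] with q hq ha hax
  exact (psiTildeB_eq hq.1 hq.2 ha hlam hxlam hax rfl rfl).symm

lemma powFrom_eq_cpow (hlam : lam ≠ 0) (hx : x ≠ 0)
    (harg : lam.arg + (x / lam).arg ∈ Set.Ioc (-Real.pi) Real.pi) (s : ℂ) :
    powFrom lam x s = x ^ s := by
  rw [powFrom, ← Complex.log_mul hlam (div_ne_zero hx hlam) harg, mul_div_cancel₀ _ hlam,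
    Complex.cpow_def_of_ne_zero hx, mul_comm]

end limit

end QBorelLaplace
end


theorem mainTheorem4 (α lam x : ℂ) (hα : ∀ k : ℕ, α ≠ (k : ℂ) + 1)
    (hlam : lam ∈ Complex.slitPlane) (hx : x ≠ 0) (hxlam : x / lam ∈ Complex.slitPlane) :
    -- for `q` close to `1` the objects are defined: the Borel transform is a meromorphic function
    -- on `ℂ*`, analytic at the points `λ qⁿ`, no theta denominator vanishes, and the Laplace
    -- series converges
    (∀ᶠ q : ℝ in 𝓝[<] 1,
      QBorelLaplace.IsMeromorphicSum
          (QBorelLaplace.qBorel (q : ℂ) (QBorelLaplace.psi10Coeff ((q : ℂ) ^ α) (q : ℂ)))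
          (QBorelLaplace.psiB ((q : ℂ) ^ α) (q : ℂ)) ∧
        (∀ n : ℤ, AnalyticAt ℂ (QBorelLaplace.psiB ((q : ℂ) ^ α) (q : ℂ)) (lam * (q : ℂ) ^ n) ∧
          QBorelLaplace.theta (q : ℂ) (lam * (q : ℂ) ^ n / (x / (1 - (q : ℂ)))) ≠ 0) ∧
        Summable (QBorelLaplace.qLaplaceTerm (q : ℂ) lam
          (QBorelLaplace.psiB ((q : ℂ) ^ α) (q : ℂ)) (x / (1 - (q : ℂ))))) ∧
    Tendsto (fun q : ℝ => QBorelLaplace.psiTildeB ((q : ℂ) ^ α) (q : ℂ) lam (x / (1 - (q : ℂ))))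
      (𝓝[<] 1)
      (𝓝 (Complex.Gamma (1 - α) * QBorelLaplace.powFrom lam x (-α) * Complex.exp (1 / x))) ∧
    -- where `Log λ + Log (x/λ)` is the principal logarithm of `x`, the power is the principal one
    (lam.arg + (x / lam).arg ∈ Set.Ioc (-Real.pi) Real.pi →
      Tendsto (fun q : ℝ => QBorelLaplace.psiTildeB ((q : ℂ) ^ α) (q : ℂ) lam (x / (1 - (q : ℂ))))
        (𝓝[<] 1)
        (𝓝 (Complex.Gamma (1 - α) * x ^ (-α) * Complex.exp (1 / x)))) := by
  have hlim := QBorelLaplace.tendsto_psiTildeB hα hlam hx hxlam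
  refine ⟨QBorelLaplace.eventually_laplace_regular hα hlam hx hxlam, hlim, fun harg => ?_⟩
  rwa [QBorelLaplace.powFrom_eq_cpow (Complex.slitPlane_ne_zero hlam) hx harg] at hlim
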